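/- Let $\alpha,\eta,\theta,R$ be real $N\times N$ matrices with $\alpha^{T}=\alpha>0$, $\eta^{T}=\eta\ge 0$, $\theta^{T}=-\theta$, $R^{T}=R\ge 0$, and let $N_R=\operatorname{rank}R>0$. On $H=\mathbb{C}^{2N}=\mathbb{C}^N\oplus\mathbb{C}^N$, with $K_p=\sqrt{\alpha}^{-1}$, $\Phi=\sqrt{\eta}\,K_p^{T}$, put $$\Omega=\begin{pmatrix}-2\mathrm{i}K_p\theta K_p^{T} & -\mathrm{i}\Phi^{T}\\ \mathrm{i}\Phi & 0\end{pmatrix},\qquad B=\begin{pmatrix}K_pRK_p^{T}&0\\0&0\end{pmatrix},\qquad A(\beta)=\Omega-\mathrm{i}\beta B\quad(\beta\ge 0),$$ the system operator of the dissipative Lagrangian system $\alpha\ddot Q+(2\theta+\beta R)\dot Q+\eta Q=0$. Let $\omega_{\max}$ be the largest eigenvalue of the Hermitian matrix $\Omega$, $b_{\min}$ the smallest nonzero eigenvalue of $B$, and $P_B^{\perp}$ the orthogonal projection onto $\operatorname{Ker}B$. Assume $N_R<N$ and $P_B^{\perp}\Omega P_B^{\perp}\ne 0$, and let $\rho_{\min}$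 be the smallest positive eigenvalue of $P_B^{\perp}\Omega P_B^{\perp}$. Define $$c(\beta)=\frac{2\omega_{\max}^2}{b_{\min}}\Bigl[\beta-\frac{2\omega_{\max}}{b_{\min}}\Bigr]^{-1}\ \Bigl(\beta>\frac{2\omega_{\max}}{b_{\min}}\Bigr),\qquad c^{-1}(y)=\frac{2\omega_{\max}^2}{b_{\min}}\,y^{-1}+\frac{2\omega_{\max}}{b_{\min}}\ (y>0).$$ For a complex number $\zeta$ let $Q_\zeta=\frac12\frac{|\operatorname{Re}\zeta|}{-\operatorname{Im}\zeta}$, with $Q_\zeta=+\infty$ if $\operatorname{Im}\zeta=0\neq\operatorname{Re}\zeta$ and $Q_0=0$. Write $D(\rho;r)$ for the closed disc of radius $r$ about $\rho$ in $\mathbb{C}$. Then $c$ is strictly decreasing on $(2\omega_{\max}/b_{\min},\infty)$, $c(\beta)\to 0$ as $\beta\to\infty$, and $\rho_{\min}/2\le\omega_{\max}/2$. For every $\beta>c^{-1}(\rho_{\min}/2)$ we have $\beta>2\omega_{\max}/b_{\min}$ and $\rho_{\min}-c(\beta)>\max\{c(\beta),\rho_{\min}/2\}$. Moreover, there are unique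 $A(\beta)$-invariant subspaces $H_{h\ell}(\beta),H_{\ell\ell}(\beta),H_{\ell\ell,0}(\beta),H_{\ell\ell,1}(\beta)$ with $H=H_{h\ell}(\beta)\oplus H_{\ell\ell}(\beta)$, $H_{\ell\ell}(\beta)=H_{\ell\ell,0}(\beta)\oplus H_{\ell\ell,1}(\beta)$ and $$\sigma(A(\beta)|_{H_{\ell\ell}(\beta)})=\sigma(A(\beta))\cap D(0;\omega_{\max}),\qquad \sigma(A(\beta)|_{H_{h\ell}(\beta)})=\sigma(A(\beta))\cap\bigcup_{0\ne b\in\sigma(B)}D(-\mathrm{i}\beta b;\omega_{\max}),$$ $$\sigma(A(\beta)|_{H_{\ell\ell,0}(\beta)})=\sigma(A(\beta))\cap D(0;c(\beta)),\qquad \sigma(A(\beta)|_{H_{\ell\ell,1}(\beta)})=\sigma(A(\beta))\cap\bigcup_{0\neq\rho\in\sigma(P_B^{\perp}\Omega P_B^{\perp})}D(\rho;c(\beta)),$$ and for these subspaces $$\sigma(A(\beta)|_{H_{\ell\ell,0}(\beta)})=\{\zeta\in\sigma(A(\beta)):0\le-\operatorname{Im}\zeta\le c(\beta)\text{ and }|\operatorname{Re}\zeta|\le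 c(\beta)\},$$ $$\sigma(A(\beta)|_{H_{\ell\ell,1}(\beta)})=\{\zeta\in\sigma(A(\beta)):0\le-\operatorname{Im}\zeta\le c(\beta)\text{ and }|\operatorname{Re}\zeta|\ge\rho_{\min}-c(\beta)\},$$ $$\min_{\zeta\in\sigma(A(\beta)|_{H_{\ell\ell,1}(\beta)})}Q_\zeta\ \ge\ \frac12\,\frac{\rho_{\min}-c(\beta)}{c(\beta)}\ >\ \frac14\,\frac{\rho_{\min}}{c(\beta)}\ \ge\ \frac12 ,$$ where the minimum is attained (the set is nonempty). In particular $\operatorname{Re}\zeta\ne 0$ for every $\zeta\in\sigma(A(\beta)|_{H_{\ell\ell,1}(\beta)})$. Consequently these modes are underdamped: if $\zeta(\beta)\in\sigma(A(\beta)|_{H_{\ell\ell,1}(\beta)})$ for all sufficiently large $\beta$, then there is $\beta'\ge0$ with $\operatorname{Re}\zeta(\beta)\neq0$ for all $\beta>\beta'$. -/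

import Mathlib

open scoped MatrixOrder

noncomputable section

/-- The data of a dissipative Lagrangian system
`α Q'' + (2 θ + β R) Q' + η Q = 0` with `N` degrees of freedom: real `N × N` matrices with
`α` symmetric positive definite, `η` and `R` symmetric positive semidefinite,
`θ` skew-symmetric, and `R` of positive rank. -/
structure LagrangianSystem (N : ℕ) where
  α : Matrix (Fin N) (Fin N) ℝ
  η : Matrix (Fin N) (Fin N) ℝ
  θ : Matrix (Fin N) (Fin N) ℝ
  R : Matrix (Fin N) (Fin N) ℝ
  posDef_α : α.PosDef
  posSemidef_η : η.PosSemidef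
  transpose_θ : θ.transpose = -θ
  posSemidef_R : R.PosSemidef
  rank_R_pos : 0 < R.rank

namespace LagrangianSystem

variable {N : ℕ} (S : LagrangianSystem N)

/-- The space `H = ℂ^{2N} = ℂ^N ⊕ ℂ^N` with its standard inner product. -/
abbrev Space (N : ℕ) : Type := EuclideanSpace ℂ (Fin N ⊕ Fin N)

/-- `K_p = (√α)⁻¹`. -/
def Kp : Matrix (Fin N) (Fin N) ℝ := (CFC.sqrt S.α)⁻¹

/-- `K_q = √η`. -/
def Kq : Matrix (Fin N) (Fin N) ℝ := CFC.sqrt S.η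

/-- `Φ = K_q K_pᵀ`. -/
def Phi : Matrix (Fin N) (Fin N) ℝ := S.Kq * S.Kp.transpose

/-- `Ω_p = -2 i K_p θ K_pᵀ`. -/
def OmegaP : Matrix (Fin N) (Fin N) ℂ :=
  (-2 * Complex.I) • (S.Kp * S.θ * S.Kp.transpose).map Complex.ofReal

/-- `R̃ = K_p R K_pᵀ`. -/
def Rtilde : Matrix (Fin N) (Fin N) ℝ := S.Kp * S.R * S.Kp.transpose

/-- The frequency operator `Ω = [[Ω_p, -i Φᵀ], [i Φ, 0]]`. -/
def Omega : Matrix (Fin N ⊕ Fin N) (Fin N ⊕ Fin N) ℂ :=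
  Matrix.fromBlocks S.OmegaP ((-Complex.I) • S.Phi.transpose.map Complex.ofReal)
    (Complex.I • S.Phi.map Complex.ofReal) 0

/-- The dissipation operator `B = [[R̃, 0], [0, 0]]`. -/
def B : Matrix (Fin N ⊕ Fin N) (Fin N ⊕ Fin N) ℂ :=
  Matrix.fromBlocks (S.Rtilde.map Complex.ofReal) 0 0 0

/-- `Ω` as an operator on `H`. -/
def opOmega : Module.End ℂ (Space N) := Matrix.toEuclideanLin S.Omega

/-- `B` as an operator on `H`. -/
def opB : Module.End ℂ (Space N) := Matrix.toEuclideanLin S.B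

/-- The system operator `A(β) = Ω - i β B` on `H`. -/
def opA (β : ℝ) : Module.End ℂ (Space N) := S.opOmega - (Complex.I * (β : ℂ)) • S.opB

/-- The orthogonal projection `P_B^⊥` of `H` onto `Ker B`. -/
def projKerB : Module.End ℂ (Space N) :=
  ((LinearMap.ker S.opB).starProjection : Space N →L[ℂ] Space N).toLinearMap

/-- The compressed operator `P_B^⊥ Ω P_B^⊥`. -/
def compOmega : Module.End ℂ (Space N) := S.projKerB * S.opOmega * S.projKerB

/-- `ω_max`, the largest eigenvalue of (the Hermitian matrix) `Ω`. -/
def omegaMax : ℝ := sSup {ω : ℝ | (ω : ℂ) ∈ spectrum ℂ S.opOmega}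

/-- `b_min`, the smallest nonzero eigenvalue of (the positive semidefinite matrix) `B`. -/
def bMin : ℝ := sInf {b : ℝ | b ≠ 0 ∧ (b : ℂ) ∈ spectrum ℂ S.opB}

/-- `ρ_min`, the smallest positive eigenvalue of `P_B^⊥ Ω P_B^⊥`; it is meaningful when this
operator is nonzero. -/
def rhoMin : ℝ := sInf {ρ : ℝ | 0 < ρ ∧ (ρ : ℂ) ∈ spectrum ℂ S.compOmega}

/-- The function `c(β) = (2 ω_max² / b_min) (β - 2 ω_max / b_min)⁻¹`, used for
`β > 2 ω_max / b_min`. -/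
def c (β : ℝ) : ℝ :=
  (2 * S.omegaMax ^ 2 / S.bMin) * (β - 2 * S.omegaMax / S.bMin)⁻¹

/-- The inverse function `c⁻¹(y) = (2 ω_max² / b_min) y⁻¹ + 2 ω_max / b_min`, used for `y > 0`. -/
def cInv (y : ℝ) : ℝ :=
  (2 * S.omegaMax ^ 2 / S.bMin) * y⁻¹ + 2 * S.omegaMax / S.bMin

/-- `σ_0(A(β))`: the part of `σ(A(β))` in the closed disc of radius `ω_max` about `0`. -/
def sigma0 (β : ℝ) : Set ℂ :=
  spectrum ℂ (S.opA β) ∩ Metric.closedBall 0 S.omegaMax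

/-- `σ_1(A(β))`: the part of `σ(A(β))` in the union of the closed discs of radius `ω_max` about
the nonzero eigenvalues `-i β b` of `-i β B`. -/
def sigma1 (β : ℝ) : Set ℂ :=
  spectrum ℂ (S.opA β) ∩
    ⋃ b ∈ spectrum ℂ S.opB \ {0}, Metric.closedBall (-(Complex.I * (β : ℂ) * b)) S.omegaMax

/-- Subspaces `H_hℓ(β)`, `H_ℓℓ(β)`, `H_ℓℓ,0(β)`, `H_ℓℓ,1(β)` invariant under `A(β)` that form the
modal dichotomy:
`H = H_hℓ ⊕ H_ℓℓ`, `σ(A|H_ℓℓ) = σ_0(A)`, `σ(A|H_hℓ) = σ_1(A)`,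
`H_ℓℓ = H_ℓℓ,0 ⊕ H_ℓℓ,1`, `σ(A|H_ℓℓ,0) = σ(A) ∩ D(0; c(β))` and
`σ(A|H_ℓℓ,1) = σ(A) ∩ ⋃ D(ρ; c(β))` over the nonzero eigenvalues `ρ` of `P_B^⊥ Ω P_B^⊥`. -/
@[ext]
structure ModalDichotomy (β : ℝ) where
  Hhl : Submodule ℂ (Space N)
  Hll : Submodule ℂ (Space N)
  Hll0 : Submodule ℂ (Space N)
  Hll1 : Submodule ℂ (Space N)
  inv_hl : ∀ x ∈ Hhl, S.opA β x ∈ Hhl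
  inv_ll : ∀ x ∈ Hll, S.opA β x ∈ Hll
  inv_ll0 : ∀ x ∈ Hll0, S.opA β x ∈ Hll0
  inv_ll1 : ∀ x ∈ Hll1, S.opA β x ∈ Hll1
  isCompl_hl_ll : IsCompl Hhl Hll
  spectrum_ll : spectrum ℂ ((S.opA β).restrict inv_ll) = S.sigma0 β
  spectrum_hl : spectrum ℂ ((S.opA β).restrict inv_hl) = S.sigma1 β
  disjoint_ll : Disjoint Hll0 Hll1
  sup_ll : Hll0 ⊔ Hll1 = Hll
  spectrum_ll0 : spectrum ℂ ((S.opA β).restrict inv_ll0) =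
    spectrum ℂ (S.opA β) ∩ Metric.closedBall 0 (S.c β)
  spectrum_ll1 : spectrum ℂ ((S.opA β).restrict inv_ll1) =
    spectrum ℂ (S.opA β) ∩ ⋃ ρ ∈ spectrum ℂ S.compOmega \ {0}, Metric.closedBall ρ (S.c β)

namespace ModalDichotomy

variable {S} {β : ℝ} (D : S.ModalDichotomy β)

/-- `σ(A(β)|H_ℓℓ,0(β))`. -/
def spec0 : Set ℂ := spectrum ℂ ((S.opA β).restrict D.inv_ll0)

/-- `σ(A(β)|H_ℓℓ,1(β))`. -/
def spec1 : Set ℂ := spectrum ℂ ((S.opA β).restrict D.inv_ll1)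

end ModalDichotomy

end LagrangianSystem

/-- The quality factor `Q_ζ = |Re ζ| / (2 (-Im ζ))`, with the conventions `Q_ζ = +∞` if
`Im ζ = 0` and `Re ζ ≠ 0`, and `Q_ζ = 0` if `ζ = 0`. -/
def qFactor (ζ : ℂ) : EReal :=
  if ζ = 0 then 0
  else if ζ.im = 0 then ⊤
  else ((1 / 2 * (|ζ.re| / (-ζ.im)) : ℝ) : EReal)

/-- A mode with time dependency `e^{-i ζ(β) t}` is underdamped if, for some `β' ≥ 0`, its
frequency `Re ζ(β)` is nonzero for all `β > β'`. -/
def IsUnderdamped (ζ : ℝ → ℂ) : Prop :=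
  ∃ β' : ℝ, 0 ≤ β' ∧ ∀ β, β' < β → (ζ β).re ≠ 0

end

/-!
Write an eigenvector of `A(β)` as `y + u` with `y ∈ Ker B` and `u ⊥ Ker B`. For a bounded
eigenvalue `ζ` the term `β B u` must be balanced by `Ω (y + u) - ζ u`, so `‖u‖` is of order
`ω_max / (β b_min)` times `‖y‖`; projecting the eigenvalue equation onto `Ker B` then shows that
`y` is an approximate eigenvector of `P_B^⊥ Ω P_B^⊥` and that `ζ` is within `c(β)` of the spectrum
of that operator. Above the threshold the discs about `0`, about the nonzero `ρ` and about
`-i β b` separate the spectrum, and the invariant subspaces must be the corresponding sums of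
generalized eigenspaces, whence uniqueness.

That the discs about the nonzero `ρ` do contain eigenvalues follows by continuity of the roots of
the characteristic polynomial. Deleting from `Ω` its off-diagonal blocks with respect to
`Ker B ⊕ (Ker B)^⊥` leaves an operator with the same compression to `Ker B` and no larger norm, for
which every such `ρ` is itself an eigenvalue. On the segment from this operator to `Ω` the
localization above holds with strict inequality, so no eigenvalue can reach the boundary of the
discs.

Complex conjugation sends `Ω` to `-Ω` and fixes `B`, so the spectra of `Ω` and `P_B^⊥ Ω P_B^⊥` are
symmetric about `0`; therefore `ω_max = ‖Ω‖`, and `ρ_min` bounds `|ρ|` from below for all nonzero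
eigenvalues `ρ`.
-/

section SpectralSubspace

open Module.End

variable {K V : Type*} [Field K] [AddCommGroup V] [Module K V]

theorem mem_spectrum_iff_exists_apply_eq_smul [FiniteDimensional K V] {T : Module.End K V}
    {z : K} : z ∈ spectrum K T ↔ ∃ x ≠ 0, T x = z • x := by
  rw [← hasEigenvalue_iff_mem_spectrum]
  constructor
  · intro hz
    obtain ⟨x, hx⟩ := hz.exists_hasEigenvector
    exact ⟨x, hx.2, hx.apply_eq_smul⟩
  · rintro ⟨x, hx, hTx⟩
    exact hasEigenvalue_of_hasEigenvector ⟨mem_eigenspace_iff.mpr hTx, hx⟩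

theorem maxGenEigenspace_eq_bot [FiniteDimensional K V] {T : Module.End K V} {z : K}
    (hz : z ∉ spectrum K T) : T.maxGenEigenspace z = ⊥ := by
  by_contra hne
  exact hz (hasEigenvalue_iff_mem_spectrum.mp (HasUnifEigenvalue.lt (k := ⊤) zero_lt_one hne))

/-- The spectral subspace of an operator `T` for a set `s` of scalars: the sum of the generalized
eigenspaces of `T` whose eigenvalue lies in `s`. In finite dimension it is the range of the Riesz
projection for `s`. -/
noncomputable def spectralSubspace (T : Module.End K V) (s : Set K) : Submodule K V :=
  ⨆ z ∈ s, T.maxGenEigenspace z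

theorem maxGenEigenspace_le_spectralSubspace (T : Module.End K V) {s : Set K} {z : K}
    (hz : z ∈ s) : T.maxGenEigenspace z ≤ spectralSubspace T s :=
  le_iSup₂_of_le z hz le_rfl

theorem apply_mem_spectralSubspace (T : Module.End K V) (s : Set K) :
    ∀ x ∈ spectralSubspace T s, T x ∈ spectralSubspace T s :=
  (iSup₂_le fun z hz _ hx ↦ maxGenEigenspace_le_spectralSubspace T hz
    (mapsTo_maxGenEigenspace_of_comm (Commute.refl T) z hx) :
    spectralSubspace T s ≤ (spectralSubspace T s).comap T)

theorem spectralSubspace_union (T : Module.End K V) (s t : Set K) :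
    spectralSubspace T (s ∪ t) = spectralSubspace T s ⊔ spectralSubspace T t :=
  iSup_union

theorem disjoint_spectralSubspace (T : Module.End K V) {s t : Set K} (hst : Disjoint s t) :
    Disjoint (spectralSubspace T s) (spectralSubspace T t) :=
  T.independent_maxGenEigenspace.disjoint_biSup_biSup hst

variable [FiniteDimensional K V]

theorem spectrum_restrict_spectralSubspace (T : Module.End K V) (s : Set K) :
    spectrum K (T.restrict (apply_mem_spectralSubspace T s)) = spectrum K T ∩ s := by
  have eigenvector_mem {x : V} {z : K} {t : Set K} (hTx : T x = z • x) (hz : z ∈ t) :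
      x ∈ spectralSubspace T t :=
    maxGenEigenspace_le_spectralSubspace T hz
      (eigenspace_le_maxGenEigenspace (mem_eigenspace_iff.mpr hTx))
  ext z
  rw [Set.mem_inter_iff, mem_spectrum_iff_exists_apply_eq_smul,
    mem_spectrum_iff_exists_apply_eq_smul]
  constructor
  · rintro ⟨⟨x, hxs⟩, hx0, hx⟩
    have hTx : T x = z • x := congrArg Subtype.val hx
    have hx0' : x ≠ 0 := fun h ↦ hx0 (Subtype.ext h)
    refine ⟨⟨x, hx0', hTx⟩, ?_⟩
    by_contra hz
    exact hx0' (Submodule.disjoint_def.mp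
      (disjoint_spectralSubspace T (Set.disjoint_singleton_left.mpr hz)) x
      (eigenvector_mem hTx rfl) hxs)
  · rintro ⟨⟨x, hx0, hTx⟩, hz⟩
    exact ⟨⟨x, eigenvector_mem hTx hz⟩, fun h ↦ hx0 (congrArg Subtype.val h), Subtype.ext hTx⟩

theorem spectrum_restrict_spectralSubspace_of_subset {T : Module.End K V} {s : Set K}
    (hs : s ⊆ spectrum K T) :
    spectrum K (T.restrict (apply_mem_spectralSubspace T s)) = s := by
  rw [spectrum_restrict_spectralSubspace, Set.inter_eq_right.mpr hs]

variable [IsAlgClosed K]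

theorem spectralSubspace_eq_top {T : Module.End K V} {s : Set K} (hs : spectrum K T ⊆ s) :
    spectralSubspace T s = ⊤ := by
  rw [eq_top_iff, ← T.iSup_maxGenEigenspace_eq_top]
  refine iSup_le fun z ↦ ?_
  by_cases hz : z ∈ spectrum K T
  · exact maxGenEigenspace_le_spectralSubspace T (hs hz)
  · simp only [maxGenEigenspace_eq_bot hz, bot_le]

theorem le_spectralSubspace_of_spectrum_restrict_subset {T : Module.End K V} {s : Set K}
    {W : Submodule K V} (hW : ∀ x ∈ W, T x ∈ W) (hs : spectrum K (T.restrict hW) ⊆ s) :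
    W ≤ spectralSubspace T s := by
  calc W = (spectralSubspace (T.restrict hW) s).map W.subtype := by
        rw [spectralSubspace_eq_top hs, Submodule.map_top, Submodule.range_subtype]
    _ ≤ spectralSubspace T s := by
        simp only [spectralSubspace, Submodule.map_iSup]
        refine iSup₂_mono fun z _ ↦ ?_
        rw [maxGenEigenspace, genEigenspace_restrict]
        exact Submodule.map_comap_le _ _

theorem eq_spectralSubspace_of_sup_eq {T : Module.End K V} {s t : Set K} (hst : Disjoint s t)
    {W W' : Submodule K V} (hW : ∀ x ∈ W, T x ∈ W) (hW' : ∀ x ∈ W', T x ∈ W')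
    (hs : spectrum K (T.restrict hW) ⊆ s) (ht : spectrum K (T.restrict hW') ⊆ t)
    (hsup : W ⊔ W' = spectralSubspace T (s ∪ t)) :
    W = spectralSubspace T s := by
  have hWs := le_spectralSubspace_of_spectrum_restrict_subset hW hs
  have hWt := le_spectralSubspace_of_spectrum_restrict_subset hW' ht
  refine eq_of_le_of_inf_le_of_sup_le (z := W') hWs ?_ ?_
  · rw [((disjoint_spectralSubspace T hst).mono_right hWt).eq_bot]
    exact bot_le
  · rw [hsup, spectralSubspace_union]
    exact sup_le_sup_left hWt _

end SpectralSubspace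

section PersistenceOfEigenvalues

open Polynomial in
theorem pow_natDegree_le_norm_eval {k : Type*} [NormedField k] {p : k[X]} (hp : p.Monic)
    (hsplit : p.Splits) {r : ℝ} (hr : 0 ≤ r) {x : k} (hx : ∀ w ∈ p.roots, r ≤ ‖x - w‖) :
    r ^ p.natDegree ≤ ‖p.eval x‖ := by
  calc r ^ p.natDegree = (p.roots.map fun _ ↦ r).prod := by
        rw [hsplit.natDegree_eq_card_roots, Multiset.map_const', Multiset.prod_replicate]
    _ ≤ (p.roots.map fun w ↦ ‖x - w‖).prod := Multiset.prod_map_le_prod_map₀ _ _ (fun _ _ ↦ hr) hx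
    _ = ‖p.eval x‖ := by
        rw [hsplit.eval_eq_prod_roots_of_monic hp]
        exact p.roots.prod_hom' (normHom : k →*₀ ℝ) (x - ·)

variable {X n k : Type*} [TopologicalSpace X] [Fintype n] [DecidableEq n] [NormedField k]

theorem mem_spectrum_iff_det_scalar_sub_eq_zero {A : Matrix n n k} {z : k} :
    z ∈ spectrum k A ↔ (Matrix.scalar n z - A).det = 0 := by
  rw [Matrix.mem_spectrum_iff_isRoot_charpoly, Polynomial.IsRoot, Matrix.eval_charpoly]

theorem isClosed_setOf_spectrum_inter_nonempty {A : X → Matrix n n k} (hA : Continuous A)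
    {K : Set k} (hK : IsCompact K) : IsClosed {t | (spectrum k (A t) ∩ K).Nonempty} := by
  have : CompactSpace K := isCompact_iff_compactSpace.mp hK
  have hgraph : IsClosed {p : X × K | (Matrix.scalar n (p.2 : k) - A p.1).det = 0} :=
    isClosed_singleton.preimage (by simp only [Matrix.scalar_apply]; fun_prop)
  convert isClosedMap_fst_of_compactSpace _ hgraph
  ext t
  simp [Set.Nonempty, mem_spectrum_iff_det_scalar_sub_eq_zero, and_comm]

theorem isOpen_setOf_spectrum_inter_nonempty [IsAlgClosed k] {A : X → Matrix n n k}
    (hA : Continuous A) {U : Set k} (hU : IsOpen U) :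
    IsOpen {t | (spectrum k (A t) ∩ U).Nonempty} := by
  rw [isOpen_iff_mem_nhds]
  rintro t ⟨z, hz, hzU⟩
  obtain ⟨r, hr, hball⟩ := Metric.isOpen_iff.mp hU z hzU
  have hcont : Continuous fun s ↦ ‖(A s).charpoly.eval z‖ := by
    simp only [Matrix.eval_charpoly]
    fun_prop
  have hlt : ‖(A t).charpoly.eval z‖ < r ^ Fintype.card n := by
    rw [Matrix.mem_spectrum_iff_isRoot_charpoly.mp hz, norm_zero]
    exact pow_pos hr _
  filter_upwards [hcont.continuousAt.eventually_lt continuousAt_const hlt] with s hs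
  by_contra hempty
  refine hs.not_ge ((A s).charpoly_natDegree_eq_dim ▸ pow_natDegree_le_norm_eval
    (A s).charpoly_monic (IsAlgClosed.splits _) hr.le fun w hw ↦ ?_)
  by_contra! hwz
  refine hempty ⟨w, ?_, hball (mem_ball_iff_norm'.mpr hwz)⟩
  exact Matrix.mem_spectrum_iff_isRoot_charpoly.mpr (Polynomial.isRoot_of_mem_roots hw)

theorem spectrum_inter_nonempty_of_preconnectedSpace [IsAlgClosed k] [PreconnectedSpace X]
    {A : X → Matrix n n k} (hA : Continuous A) {U K : Set k} (hU : IsOpen U) (hK : IsCompact K)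
    (hUK : U ⊆ K) (hAU : ∀ t, spectrum k (A t) ∩ K ⊆ U) {t₀ : X}
    (h₀ : (spectrum k (A t₀) ∩ K).Nonempty) (t : X) : (spectrum k (A t) ∩ K).Nonempty := by
  have heq : {t | (spectrum k (A t) ∩ K).Nonempty} = {t | (spectrum k (A t) ∩ U).Nonempty} :=
    Set.ext fun t ↦ ⟨fun ⟨z, hz⟩ ↦ ⟨z, hz.1, hAU t hz⟩, fun ⟨z, hz⟩ ↦ ⟨z, hz.1, hUK hz.2⟩⟩
  have hclopen : IsClopen {t | (spectrum k (A t) ∩ K).Nonempty} :=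
    ⟨isClosed_setOf_spectrum_inter_nonempty hA hK,
      heq ▸ isOpen_setOf_spectrum_inter_nonempty hA hU⟩
  exact Set.eq_univ_iff_forall.mp (hclopen.eq_univ ⟨t₀, h₀⟩) t

theorem spectrum_inter_nonempty_of_convex {V : Type*} [AddCommGroup V] [Module ℂ V]
    [FiniteDimensional ℂ V] {𝒯 : Set (Module.End ℂ V)} (h𝒯 : Convex ℝ 𝒯) {U K : Set ℂ}
    (hU : IsOpen U) (hK : IsCompact K) (hUK : U ⊆ K) (h𝒯U : ∀ T ∈ 𝒯, spectrum ℂ T ∩ K ⊆ U)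
    {T₀ T₁ : Module.End ℂ V} (h₀ : T₀ ∈ 𝒯) (h₁ : T₁ ∈ 𝒯)
    (hne : (spectrum ℂ T₀ ∩ K).Nonempty) : (spectrum ℂ T₁ ∩ K).Nonempty := by
  let toMat := LinearMap.toMatrixAlgEquiv (Module.finBasis ℂ V)
  let A : unitInterval → Matrix _ _ ℂ := fun t ↦ toMat (AffineMap.lineMap T₀ T₁ (t : ℝ))
  have hA : Continuous A := by
    simp only [A, AffineMap.lineMap_apply_module, map_add, ← Complex.coe_smul,
      map_smul]
    fun_prop
  have hspec (T : Module.End ℂ V) : spectrum ℂ (toMat T) = spectrum ℂ T :=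
    AlgEquiv.spectrum_eq toMat T
  have := spectrum_inter_nonempty_of_preconnectedSpace hA hU hK hUK
    (fun t ↦ (hspec _).symm ▸ h𝒯U _ (h𝒯.lineMap_mem h₀ h₁ t.2)) (t₀ := 0)
    (by simpa [A, hspec] using hne) 1
  simpa [A, hspec] using this

end PersistenceOfEigenvalues

section SymmetricOperators

open scoped InnerProductSpace

variable {𝕜 E : Type*} [RCLike 𝕜] [NormedAddCommGroup E] [InnerProductSpace 𝕜 E]

section OrthonormalEigenbasis

variable {ι : Type*} [Fintype ι] {T : E →ₗ[𝕜] E} {v : OrthonormalBasis ι 𝕜 E} {μ : ι → 𝕜}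

theorem norm_apply_sq_eq_sum_of_eigenbasis (hv : ∀ i, T (v i) = μ i • v i) (x : E) :
    ‖T x‖ ^ 2 = ∑ i, ‖μ i‖ ^ 2 * ‖⟪v i, x⟫_𝕜‖ ^ 2 := by
  have hcoord (i : ι) : ⟪v i, T x⟫_𝕜 = μ i * ⟪v i, x⟫_𝕜 := by
    nth_rw 1 [← v.sum_repr x]
    simp only [map_sum, map_smul, hv, smul_smul]
    rw [v.orthonormal.inner_right_fintype, v.repr_apply_apply, mul_comm]
  simp only [← v.sum_sq_norm_inner_right (T x), hcoord, norm_mul, mul_pow]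

theorem norm_apply_le_of_eigenbasis (hv : ∀ i, T (v i) = μ i • v i) {M : ℝ} (hM : 0 ≤ M)
    (hμ : ∀ i, ‖μ i‖ ≤ M) (x : E) : ‖T x‖ ≤ M * ‖x‖ := by
  refine le_of_sq_le_sq ?_ (by positivity)
  rw [norm_apply_sq_eq_sum_of_eigenbasis hv, mul_pow, ← v.sum_sq_norm_inner_right x,
    Finset.mul_sum]
  gcongr with i
  exact hμ i

theorem mul_norm_le_norm_apply_of_eigenbasis (hv : ∀ i, T (v i) = μ i • v i) {d : ℝ}
    (hd : 0 ≤ d) {x : E} (hμ : ∀ i, d ≤ ‖μ i‖ ∨ ⟪v i, x⟫_𝕜 = 0) : d * ‖x‖ ≤ ‖T x‖ := by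
  refine le_of_sq_le_sq ?_ (norm_nonneg _)
  rw [norm_apply_sq_eq_sum_of_eigenbasis hv, mul_pow, ← v.sum_sq_norm_inner_right x,
    Finset.mul_sum]
  refine Finset.sum_le_sum fun i _ ↦ ?_
  obtain hi | hi := hμ i
  · gcongr
  · simp [hi]

theorem exists_norm_mul_norm_le_norm_apply_of_eigenbasis (hv : ∀ i, T (v i) = μ i • v i)
    {x : E} (hx : x ≠ 0) : ∃ i, ‖μ i‖ * ‖x‖ ≤ ‖T x‖ := by
  have : Nontrivial E := nontrivial_of_ne x 0 hx
  have : Nonempty ι := v.toBasis.index_nonempty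
  obtain ⟨i, hi⟩ := Finite.exists_min fun i ↦ ‖μ i‖
  exact ⟨i, mul_norm_le_norm_apply_of_eigenbasis hv (norm_nonneg _) fun j ↦ .inl (hi j)⟩

end OrthonormalEigenbasis

variable [FiniteDimensional 𝕜 E] {T : Module.End 𝕜 E}

theorem eigenvalues_mem_spectrum (hT : LinearMap.IsSymmetric T)
    (i : Fin (Module.finrank 𝕜 E)) : (hT.eigenvalues rfl i : 𝕜) ∈ spectrum 𝕜 T :=
  Module.End.hasEigenvalue_iff_mem_spectrum.mp (hT.hasEigenvalue_eigenvalues rfl i)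

theorem finite_setOf_ofReal_mem_spectrum (T : Module.End 𝕜 E) :
    {μ : ℝ | (μ : 𝕜) ∈ spectrum 𝕜 T}.Finite :=
  T.finite_spectrum.preimage RCLike.ofReal_injective.injOn

theorem ofReal_re_eq_of_mem_spectrum (hT : LinearMap.IsSymmetric T) {z : 𝕜}
    (hz : z ∈ spectrum 𝕜 T) : (RCLike.re z : 𝕜) = z :=
  RCLike.conj_eq_iff_re.mp
    (hT.conj_eigenvalue_eq_self (Module.End.hasEigenvalue_iff_mem_spectrum.mpr hz))

theorem norm_apply_le_of_isSymmetric (hT : LinearMap.IsSymmetric T) {M : ℝ} (hM : 0 ≤ M)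
    (hTM : ∀ μ : ℝ, (μ : 𝕜) ∈ spectrum 𝕜 T → |μ| ≤ M) (x : E) : ‖T x‖ ≤ M * ‖x‖ :=
  norm_apply_le_of_eigenbasis (hT.apply_eigenvectorBasis rfl) hM
    (fun i ↦ (RCLike.norm_ofReal _).trans_le (hTM _ (eigenvalues_mem_spectrum hT i))) x

theorem exists_ne_zero_ofReal_mem_spectrum (hT : LinearMap.IsSymmetric T) (hT0 : T ≠ 0) :
    ∃ μ : ℝ, μ ≠ 0 ∧ (μ : 𝕜) ∈ spectrum 𝕜 T := by
  by_contra! hspec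
  refine hT0 (LinearMap.ext fun x ↦ norm_le_zero_iff.mp ?_)
  simpa only [zero_mul] using norm_apply_le_of_isSymmetric hT le_rfl
    (fun μ hμ ↦ (abs_eq_zero.mpr (not_imp_comm.mp (hspec μ) (not_not.mpr hμ))).le) x

theorem exists_mem_spectrum_norm_mul_sub_mul_norm_le (hT : LinearMap.IsSymmetric T) (a z : 𝕜)
    {x : E} (hx : x ≠ 0) :
    ∃ μ : ℝ, (μ : 𝕜) ∈ spectrum 𝕜 T ∧ ‖a * μ - z‖ * ‖x‖ ≤ ‖a • T x - z • x‖ := by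
  obtain ⟨i, hi⟩ := exists_norm_mul_norm_le_norm_apply_of_eigenbasis
    (T := a • T - z • 1) (v := hT.eigenvectorBasis rfl) (μ := fun i ↦ a * hT.eigenvalues rfl i - z)
    (fun i ↦ by simp [sub_smul, mul_smul, hT.apply_eigenvectorBasis]) hx
  exact ⟨_, eigenvalues_mem_spectrum hT i, hi⟩

theorem mul_norm_sub_starProjection_ker_le (hT : LinearMap.IsSymmetric T) {d : ℝ} (hd : 0 ≤ d)
    (hTd : ∀ μ : ℝ, μ ≠ 0 → (μ : 𝕜) ∈ spectrum 𝕜 T → d ≤ |μ|) (x : E) :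
    d * ‖x - T.ker.starProjection x‖ ≤ ‖T x‖ := by
  have hTx : T (x - T.ker.starProjection x) = T x := by
    rw [map_sub, LinearMap.mem_ker.mp (Submodule.starProjection_apply_mem _ x), sub_zero]
  rw [← hTx]
  refine mul_norm_le_norm_apply_of_eigenbasis (hT.apply_eigenvectorBasis rfl) hd fun i ↦ ?_
  by_cases hi : hT.eigenvalues rfl i = 0
  · right
    refine Submodule.sub_starProjection_mem_orthogonal x _ (LinearMap.mem_ker.mpr ?_)
    rw [hT.apply_eigenvectorBasis, hi, RCLike.ofReal_zero, zero_smul]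
  · left
    rw [RCLike.norm_ofReal]
    exact hTd _ hi (eigenvalues_mem_spectrum hT i)

theorem norm_le_of_mem_spectrum {M : ℝ} (hTM : ∀ x, ‖T x‖ ≤ M * ‖x‖) {z : 𝕜}
    (hz : z ∈ spectrum 𝕜 T) : ‖z‖ ≤ M := by
  obtain ⟨x, hx, hTx⟩ := mem_spectrum_iff_exists_apply_eq_smul.mp hz
  have hle := hTM x
  rw [hTx, norm_smul] at hle
  exact le_of_mul_le_mul_right hle (norm_pos_iff.mpr hx)

theorem starProjection_ker_apply_eq_zero (hT : LinearMap.IsSymmetric T) (x : E) :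
    T.ker.starProjection (T x) = 0 := by
  refine Submodule.eq_starProjection_of_mem_of_inner_eq_zero (zero_mem _) fun y hy ↦ ?_
  rw [sub_zero, hT, LinearMap.mem_ker.mp hy, inner_zero_right]

end SymmetricOperators

section Compression

variable {𝕜 E : Type*} [RCLike 𝕜] [NormedAddCommGroup E] [InnerProductSpace 𝕜 E]

/-- The compression `P T P` of an operator `T` to a subspace `K`, where `P` is the orthogonal
projection onto `K`; it is an operator on the whole space, which vanishes on `Kᗮ`. -/
noncomputable def compression (K : Submodule 𝕜 E) [K.HasOrthogonalProjection]
    (T : Module.End 𝕜 E) : Module.End 𝕜 E :=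
  K.starProjection.toLinearMap * T * K.starProjection.toLinearMap

/-- The pinching of an operator `T` with respect to `E = K ⊕ Kᗮ`: the block diagonal operator that
is left when the coupling between the two summands is removed from `T`. -/
noncomputable def pinching (K : Submodule 𝕜 E) [K.HasOrthogonalProjection]
    (T : Module.End 𝕜 E) : Module.End 𝕜 E :=
  compression K T + compression Kᗮ T

variable {K : Submodule 𝕜 E} [K.HasOrthogonalProjection] {T : Module.End 𝕜 E}

theorem compression_apply (x : E) :
    compression K T x = K.starProjection (T (K.starProjection x)) :=
  rfl

theorem isSymmetric_compression (hT : LinearMap.IsSymmetric T) :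
    LinearMap.IsSymmetric (compression K T) := fun x y ↦ by
  rw [compression_apply, compression_apply, K.inner_starProjection_left_eq_right, hT,
    K.inner_starProjection_left_eq_right]

theorem compression_apply_mem (x : E) : compression K T x ∈ K :=
  Submodule.starProjection_apply_mem _ _

theorem norm_compression_apply_le {M : ℝ} (hT : ∀ x, ‖T x‖ ≤ M * ‖x‖) (x : E) :
    ‖compression K T x‖ ≤ M * ‖K.starProjection x‖ :=
  (K.norm_starProjection_apply_le _).trans (hT _)

theorem norm_pinching_apply_le {M : ℝ} (hM : 0 ≤ M) (hT : ∀ x, ‖T x‖ ≤ M * ‖x‖) (x : E) :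
    ‖pinching K T x‖ ≤ M * ‖x‖ := by
  have horth := Submodule.inner_right_of_mem_orthogonal
    (compression_apply_mem (K := K) (T := T) x) (compression_apply_mem (K := Kᗮ) (T := T) x)
  refine le_of_sq_le_sq ?_ (by positivity)
  calc ‖pinching K T x‖ ^ 2
      = ‖compression K T x‖ ^ 2 + ‖compression Kᗮ T x‖ ^ 2 := by
        simpa only [pinching, LinearMap.add_apply, ← sq] using
          norm_add_sq_eq_norm_sq_add_norm_sq_of_inner_eq_zero _ _ horth
    _ ≤ (M * ‖K.starProjection x‖) ^ 2 + (M * ‖Kᗮ.starProjection x‖) ^ 2 := by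
        gcongr <;> exact norm_compression_apply_le hT x
    _ = (M * ‖x‖) ^ 2 := by
        rw [mul_pow, mul_pow, mul_pow, ← mul_add, ← K.norm_sq_eq_add_norm_sq_starProjection]

theorem pinching_apply_of_mem {x : E} (hx : x ∈ K) : pinching K T x = compression K T x := by
  simp only [pinching, LinearMap.add_apply, compression_apply,
    Submodule.starProjection_orthogonal_val, Submodule.starProjection_eq_self_iff.mpr hx,
    sub_self, map_zero, add_zero]

theorem compression_pinching : compression K (pinching K T) = compression K T := by
  ext x
  rw [compression_apply, pinching_apply_of_mem (Submodule.starProjection_apply_mem _ _),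
    Submodule.starProjection_eq_self_iff.mpr (compression_apply_mem _), compression_apply,
    compression_apply, Submodule.starProjection_eq_self_iff.mpr
      (Submodule.starProjection_apply_mem _ _)]

end Compression

section Dissipation

open scoped InnerProductSpace

variable {E : Type*} [NormedAddCommGroup E] [InnerProductSpace ℂ E]

theorem convex_setOf_norm_apply_le_and_compression_eq {K : Submodule ℂ E}
    [K.HasOrthogonalProjection] (M : ℝ) (C : Module.End ℂ E) :
    Convex ℝ {S : Module.End ℂ E | (∀ x, ‖S x‖ ≤ M * ‖x‖) ∧ compression K S = C} := by
  rintro S ⟨hS, rfl⟩ S' ⟨hS', hSS'⟩ s t hs ht hst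
  refine ⟨fun x ↦ ?_, LinearMap.ext fun x ↦ ?_⟩
  · have hball := convex_closedBall (0 : E) (M * ‖x‖)
    exact mem_closedBall_zero_iff.mp (hball (mem_closedBall_zero_iff.mpr (hS x))
      (mem_closedBall_zero_iff.mpr (hS' x)) hs ht hst)
  · calc compression K (s • S + t • S') x = s • compression K S x + t • compression K S' x := by
          simp only [compression_apply, LinearMap.add_apply, LinearMap.smul_apply, map_add,
            ← Complex.coe_smul, map_smul]
      _ = compression K S x := by rw [hSS', Convex.combo_self hst]

theorem im_nonpos_of_mem_spectrum_sub_smul [FiniteDimensional ℂ E] {Ω B : Module.End ℂ E}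
    (hΩ : LinearMap.IsSymmetric Ω) (hB : LinearMap.IsPositive B) {β : ℝ} (hβ : 0 ≤ β) {z : ℂ}
    (hz : z ∈ spectrum ℂ (Ω - (Complex.I * β) • B)) : z.im ≤ 0 := by
  obtain ⟨x, hx, hAx⟩ := mem_spectrum_iff_exists_apply_eq_smul.mp hz
  have hquad : z.im * ‖x‖ ^ 2 = -(β * (⟪x, B x⟫_ℂ).re) := by
    have him := congrArg (fun y ↦ (⟪x, y⟫_ℂ).im) hAx
    have hΩim : (⟪x, Ω x⟫_ℂ).im = 0 := hΩ.im_inner_self_apply x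
    simp only [LinearMap.sub_apply, LinearMap.smul_apply, inner_sub_right, inner_smul_right,
      inner_self_eq_norm_sq_to_K, Complex.sub_im, hΩim] at him
    simpa [← Complex.ofReal_pow, mul_assoc] using him.symm
  have hBx : 0 ≤ (⟪x, B x⟫_ℂ).re := hB.re_inner_nonneg_right x
  have hpos : 0 < ‖x‖ ^ 2 := by positivity
  nlinarith [mul_nonneg hβ hBx]

variable [FiniteDimensional ℂ E] {Ω B : Module.End ℂ E} {a : ℂ} {b ω r : ℝ}

theorem exists_mem_spectrum_norm_mul_add_le (hB : LinearMap.IsSymmetric B)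
    (hω : ∀ x, ‖Ω x‖ ≤ ω * ‖x‖) {z : ℂ} (hz : z ∈ spectrum ℂ (Ω - a • B)) :
    ∃ μ : ℝ, (μ : ℂ) ∈ spectrum ℂ B ∧ ‖a * μ + z‖ ≤ ω := by
  obtain ⟨x, hx, hAx⟩ := mem_spectrum_iff_exists_apply_eq_smul.mp hz
  obtain ⟨μ, hμ, hle⟩ := exists_mem_spectrum_norm_mul_sub_mul_norm_le hB a (-z) hx
  have hBx : a • B x - -z • x = Ω x := by
    rw [neg_smul, ← hAx, LinearMap.sub_apply, LinearMap.smul_apply]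
    abel
  rw [hBx, sub_neg_eq_add] at hle
  exact ⟨μ, hμ, le_of_mul_le_mul_right (hle.trans (hω x)) (norm_pos_iff.mpr hx)⟩

theorem mul_norm_sub_starProjection_ker_le_of_eigenvector (hB : LinearMap.IsSymmetric B)
    (hb : 0 ≤ b) (hBb : ∀ μ : ℝ, μ ≠ 0 → (μ : ℂ) ∈ spectrum ℂ B → b ≤ |μ|)
    (hω : ∀ x, ‖Ω x‖ ≤ ω * ‖x‖) (hω0 : 0 ≤ ω) {z : ℂ} {x : E} (hx : Ω x - a • B x = z • x) :
    (‖a‖ * b - ω - ‖z‖) * ‖x - B.ker.starProjection x‖ ≤ ω * ‖B.ker.starProjection x‖ := by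
  set y := B.ker.starProjection x with hy
  set u := x - y with hu
  have hBx : a • B x = B.kerᗮ.starProjection (Ω x) - z • u := by
    have haB : a • B x = Ω x - z • x := by rw [← hx, sub_sub_cancel]
    have hBorth : B.kerᗮ.starProjection (a • B x) = a • B x := by
      rw [Submodule.starProjection_orthogonal_val, map_smul, starProjection_ker_apply_eq_zero hB,
        smul_zero, sub_zero]
    rw [← hBorth, haB, map_sub, map_smul, hu, hy, ← Submodule.starProjection_orthogonal_val]
  have hupper : ‖a • B x‖ ≤ ω * (‖y‖ + ‖u‖) + ‖z‖ * ‖u‖ := by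
    calc ‖a • B x‖ ≤ ‖B.kerᗮ.starProjection (Ω x)‖ + ‖z • u‖ := hBx ▸ norm_sub_le _ _
      _ ≤ ω * ‖y + u‖ + ‖z‖ * ‖u‖ := by
        rw [norm_smul, hu, add_sub_cancel]
        gcongr
        exact (Submodule.norm_starProjection_apply_le _ _).trans (hω x)
      _ ≤ ω * (‖y‖ + ‖u‖) + ‖z‖ * ‖u‖ := by
        gcongr
        exact norm_add_le _ _
  have hlower : ‖a‖ * (b * ‖u‖) ≤ ‖a • B x‖ := by
    rw [norm_smul]
    gcongr
    exact mul_norm_sub_starProjection_ker_le hB hb hBb x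
  linarith

theorem norm_compression_ker_sub_smul_le_of_eigenvector (hB : LinearMap.IsSymmetric B)
    (hω : ∀ x, ‖Ω x‖ ≤ ω * ‖x‖) {z : ℂ} {x : E} (hx : Ω x - a • B x = z • x) :
    ‖compression B.ker Ω (B.ker.starProjection x) - z • B.ker.starProjection x‖ ≤
      ω * ‖x - B.ker.starProjection x‖ := by
  set P := B.ker.starProjection with hP
  have hPx : P (Ω x) = z • P x := by
    rw [← map_smul, ← hx, map_sub, map_smul, starProjection_ker_apply_eq_zero hB, smul_zero,
      sub_zero]
  have hPP : P (P x) = P x :=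
    Submodule.starProjection_eq_self_iff.mpr (Submodule.starProjection_apply_mem _ _)
  calc ‖compression B.ker Ω (P x) - z • P x‖ = ‖P (Ω (x - P x))‖ := by
        rw [compression_apply, ← hP, hPP, map_sub, map_sub, hPx, norm_sub_rev]
    _ ≤ ω * ‖x - P x‖ := (Submodule.norm_starProjection_apply_le _ _).trans (hω _)

theorem exists_mem_spectrum_compression_norm_sub_mul_le (hB : LinearMap.IsSymmetric B)
    (hb : 0 ≤ b) (hBb : ∀ μ : ℝ, μ ≠ 0 → (μ : ℂ) ∈ spectrum ℂ B → b ≤ |μ|)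
    (hω : ∀ x, ‖Ω x‖ ≤ ω * ‖x‖) (hω0 : 0 ≤ ω)
    (hC : LinearMap.IsSymmetric (compression B.ker Ω)) {z : ℂ}
    (hz : z ∈ spectrum ℂ (Ω - a • B)) (hzb : ω + ‖z‖ < ‖a‖ * b) :
    ∃ ρ : ℝ, (ρ : ℂ) ∈ spectrum ℂ (compression B.ker Ω) ∧
      ‖(ρ : ℂ) - z‖ * (‖a‖ * b - ω - ‖z‖) ≤ ω ^ 2 := by
  obtain ⟨x, hx, hAx⟩ := mem_spectrum_iff_exists_apply_eq_smul.mp hz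
  have hsmall := mul_norm_sub_starProjection_ker_le_of_eigenvector hB hb hBb hω hω0 hAx
  have hresidual := norm_compression_ker_sub_smul_le_of_eigenvector hB hω hAx
  set y := B.ker.starProjection x
  have hgap : 0 < ‖a‖ * b - ω - ‖z‖ := by linarith
  have hy : y ≠ 0 := by
    intro hy
    rw [hy, sub_zero, norm_zero, mul_zero] at hsmall
    exact hx (norm_le_zero_iff.mp (nonpos_of_mul_nonpos_right hsmall hgap))
  obtain ⟨ρ, hρ, hle⟩ := exists_mem_spectrum_norm_mul_sub_mul_norm_le hC 1 z hy
  rw [one_mul, one_smul] at hle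
  refine ⟨ρ, hρ, le_of_mul_le_mul_right ?_ (norm_pos_iff.mpr hy)⟩
  calc ‖(ρ : ℂ) - z‖ * (‖a‖ * b - ω - ‖z‖) * ‖y‖
      = (‖a‖ * b - ω - ‖z‖) * (‖(ρ : ℂ) - z‖ * ‖y‖) := by ring
    _ ≤ (‖a‖ * b - ω - ‖z‖) * (ω * ‖x - y‖) :=
        mul_le_mul_of_nonneg_left (hle.trans hresidual) hgap.le
    _ = ω * ((‖a‖ * b - ω - ‖z‖) * ‖x - y‖) := by ring
    _ ≤ ω * (ω * ‖y‖) := by gcongr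
    _ = ω ^ 2 * ‖y‖ := by ring

theorem mem_spectrum_pinching_ker_sub_smul (a : ℂ) {ρ : ℂ} (hρ0 : ρ ≠ 0)
    (hρ : ρ ∈ spectrum ℂ (compression B.ker Ω)) :
    ρ ∈ spectrum ℂ (pinching B.ker Ω - a • B) := by
  obtain ⟨x, hx, hCx⟩ := mem_spectrum_iff_exists_apply_eq_smul.mp hρ
  have hxker : x ∈ B.ker :=
    (Submodule.smul_mem_iff _ hρ0).mp (hCx ▸ compression_apply_mem x)
  refine mem_spectrum_iff_exists_apply_eq_smul.mpr ⟨x, hx, ?_⟩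
  rw [LinearMap.sub_apply, LinearMap.smul_apply, pinching_apply_of_mem hxker,
    LinearMap.mem_ker.mp hxker, smul_zero, sub_zero, hCx]

theorem exists_mem_ball_of_mem_closedBall (hB : LinearMap.IsSymmetric B)
    (hb : 0 ≤ b) (hBb : ∀ μ : ℝ, μ ≠ 0 → (μ : ℂ) ∈ spectrum ℂ B → b ≤ |μ|)
    (hω : ∀ x, ‖Ω x‖ ≤ ω * ‖x‖) (hω0 : 0 ≤ ω)
    (hC : LinearMap.IsSymmetric (compression B.ker Ω))
    (hgap : ω ^ 2 < r * (‖a‖ * b - 2 * ω - r)) (hr : 0 ≤ r)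
    (hCr : ∀ ρ ∈ spectrum ℂ (compression B.ker Ω) \ {0}, 2 * r ≤ ‖ρ‖) {z : ℂ}
    (hz : z ∈ spectrum ℂ (Ω - a • B)) {ρ : ℂ} (hρ : ρ ∈ spectrum ℂ (compression B.ker Ω) \ {0})
    (hzρ : z ∈ Metric.closedBall ρ r) :
    ∃ ρ' ∈ spectrum ℂ (compression B.ker Ω) \ {0}, z ∈ Metric.ball ρ' r := by
  rw [mem_closedBall_iff_norm] at hzρ
  have hgap_pos : 0 < ‖a‖ * b - 2 * ω - r :=
    pos_of_mul_pos_right ((sq_nonneg ω).trans_lt hgap) hr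
  have hρω : ‖ρ‖ ≤ ω := norm_le_of_mem_spectrum (fun x ↦ (norm_compression_apply_le hω x).trans
    (mul_le_mul_of_nonneg_left (Submodule.norm_starProjection_apply_le _ x) hω0)) hρ.1
  have hzω : ‖z‖ ≤ ω + r := by linarith [norm_le_norm_add_norm_sub' z ρ]
  obtain ⟨ρ', hρ', hle⟩ :=
    exists_mem_spectrum_compression_norm_sub_mul_le hB hb hBb hω hω0 hC hz (by linarith)
  have hzρ' : ‖z - ρ'‖ < r := by
    rw [norm_sub_rev]
    refine lt_of_mul_lt_mul_right ?_ hgap_pos.le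
    calc ‖(ρ' : ℂ) - z‖ * (‖a‖ * b - 2 * ω - r) ≤ ‖(ρ' : ℂ) - z‖ * (‖a‖ * b - ω - ‖z‖) :=
          mul_le_mul_of_nonneg_left (by linarith) (norm_nonneg _)
      _ < r * (‖a‖ * b - 2 * ω - r) := hle.trans_lt hgap
  have hρ'0 : (ρ' : ℂ) ≠ 0 := by
    intro h0
    rw [h0, sub_zero] at hzρ'
    linarith [hCr ρ hρ, norm_le_norm_add_norm_sub z ρ]
  exact ⟨ρ', ⟨hρ', hρ'0⟩, mem_ball_iff_norm.mpr hzρ'⟩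

theorem spectrum_inter_iUnion_closedBall_nonempty (hB : LinearMap.IsSymmetric B)
    (hb : 0 ≤ b) (hBb : ∀ μ : ℝ, μ ≠ 0 → (μ : ℂ) ∈ spectrum ℂ B → b ≤ |μ|)
    (hω : ∀ x, ‖Ω x‖ ≤ ω * ‖x‖) (hω0 : 0 ≤ ω)
    (hC : LinearMap.IsSymmetric (compression B.ker Ω)) (hC0 : compression B.ker Ω ≠ 0)
    (hgap : ω ^ 2 < r * (‖a‖ * b - 2 * ω - r)) (hr : 0 ≤ r)
    (hCr : ∀ ρ ∈ spectrum ℂ (compression B.ker Ω) \ {0}, 2 * r ≤ ‖ρ‖) :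
    (spectrum ℂ (Ω - a • B) ∩
      ⋃ ρ ∈ spectrum ℂ (compression B.ker Ω) \ {0}, Metric.closedBall ρ r).Nonempty := by
  set C := compression B.ker Ω
  let 𝒯 : Set (Module.End ℂ E) :=
    (· + a • B) ⁻¹' {T | (∀ x, ‖T x‖ ≤ ω * ‖x‖) ∧ compression B.ker T = C}
  have h𝒯 : Convex ℝ 𝒯 :=
    (convex_setOf_norm_apply_le_and_compression_eq ω C).translate_preimage_left (a • B)
  have hcompact : IsCompact (⋃ ρ ∈ spectrum ℂ C \ {0}, Metric.closedBall ρ r) :=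
    C.finite_spectrum.sdiff.isCompact_biUnion fun ρ _ ↦ isCompact_closedBall ρ r
  have hstay : ∀ T ∈ 𝒯, spectrum ℂ T ∩ ⋃ ρ ∈ spectrum ℂ C \ {0}, Metric.closedBall ρ r ⊆
      ⋃ ρ ∈ spectrum ℂ C \ {0}, Metric.ball ρ r := by
    rintro T ⟨hTω, hTC⟩ z ⟨hz, hzρ⟩
    obtain ⟨ρ, hρ, hzρ⟩ := Set.mem_iUnion₂.mp hzρ
    rw [← hTC] at hC hCr hρ ⊢
    rw [← add_sub_cancel_right T (a • B)] at hz
    simpa only [Set.mem_iUnion₂, exists_prop] using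
      exists_mem_ball_of_mem_closedBall hB hb hBb hTω hω0 hC hgap hr hCr hz hρ hzρ
  refine spectrum_inter_nonempty_of_convex h𝒯
    (isOpen_biUnion fun ρ _ ↦ Metric.isOpen_ball) hcompact
    (Set.iUnion₂_mono fun ρ _ ↦ Metric.ball_subset_closedBall) hstay
    (T₀ := pinching B.ker Ω - a • B) ?_ ?_ ?_
  · simpa [𝒯] using ⟨norm_pinching_apply_le hω0 hω, compression_pinching⟩
  · simpa [𝒯] using ⟨hω, rfl⟩
  · obtain ⟨ρ, hρ0, hρ⟩ := exists_ne_zero_ofReal_mem_spectrum hC hC0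
    have hρ0 : (ρ : ℂ) ≠ 0 := Complex.ofReal_ne_zero.mpr hρ0
    exact ⟨ρ, mem_spectrum_pinching_ker_sub_smul a hρ0 hρ,
      Set.mem_biUnion ⟨hρ, hρ0⟩ (Metric.mem_closedBall_self hr)⟩

end Dissipation

section ComplexConjugation

open scoped InnerProductSpace

variable {𝕜 E : Type*} [RCLike 𝕜] [NormedAddCommGroup E] [InnerProductSpace 𝕜 E]
  {J : E →ₛₗ[starRingEnd 𝕜] E}

theorem neg_conj_mem_spectrum [FiniteDimensional 𝕜 E] (hJ : Function.Injective J)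
    {T : Module.End 𝕜 E} (hTJ : ∀ x, T (J x) = -J (T x)) {z : 𝕜} (hz : z ∈ spectrum 𝕜 T) :
    -starRingEnd 𝕜 z ∈ spectrum 𝕜 T := by
  obtain ⟨x, hx, hTx⟩ := mem_spectrum_iff_exists_apply_eq_smul.mp hz
  refine mem_spectrum_iff_exists_apply_eq_smul.mpr ⟨J x, (map_ne_zero_iff J hJ).mpr hx, ?_⟩
  rw [hTJ, hTx, map_smulₛₗ, neg_smul]

variable {K : Submodule 𝕜 E} [K.HasOrthogonalProjection]

theorem starProjection_apply_semilinear (hJ : ∀ x y, ⟪J x, y⟫_𝕜 = ⟪J y, x⟫_𝕜)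
    (hJK : ∀ x ∈ K, J x ∈ K) (x : E) : K.starProjection (J x) = J (K.starProjection x) := by
  refine Submodule.eq_starProjection_of_mem_of_inner_eq_zero
    (hJK _ (Submodule.starProjection_apply_mem _ x)) fun y hy ↦ ?_
  rw [← map_sub, hJ]
  exact Submodule.sub_starProjection_mem_orthogonal x _ (hJK y hy)

theorem compression_apply_semilinear (hJ : ∀ x y, ⟪J x, y⟫_𝕜 = ⟪J y, x⟫_𝕜)
    (hJK : ∀ x ∈ K, J x ∈ K) {T : Module.End 𝕜 E} (hTJ : ∀ x, T (J x) = -J (T x)) (x : E) :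
    compression K T (J x) = -J (compression K T x) := by
  simp only [compression_apply, starProjection_apply_semilinear hJ hJK, hTJ, map_neg]

variable {ι : Type*}

/-- Coordinatewise complex conjugation on a Euclidean space, as a semilinear map. -/
def euclideanConj (𝕜 ι : Type*) [RCLike 𝕜] :
    EuclideanSpace 𝕜 ι →ₛₗ[starRingEnd 𝕜] EuclideanSpace 𝕜 ι where
  toFun x := WithLp.toLp 2 (star x.ofLp)
  map_add' x y := by ext; simp
  map_smul' a x := by ext; simp

@[simp]
theorem euclideanConj_apply (x : EuclideanSpace 𝕜 ι) (i : ι) :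
    euclideanConj 𝕜 ι x i = starRingEnd 𝕜 (x i) :=
  rfl

theorem euclideanConj_injective : Function.Injective (euclideanConj 𝕜 ι) := by
  intro x y hxy
  ext i
  exact star_injective (congrArg (· i) hxy)

variable [Fintype ι]

theorem inner_euclideanConj_comm (x y : EuclideanSpace 𝕜 ι) :
    ⟪euclideanConj 𝕜 ι x, y⟫_𝕜 = ⟪euclideanConj 𝕜 ι y, x⟫_𝕜 := by
  simp [PiLp.inner_apply, mul_comm]

theorem toEuclideanLin_euclideanConj [DecidableEq ι] (M : Matrix ι ι 𝕜)
    (x : EuclideanSpace 𝕜 ι) :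
    Matrix.toEuclideanLin M (euclideanConj 𝕜 ι x) =
      euclideanConj 𝕜 ι (Matrix.toEuclideanLin (M.map (starRingEnd 𝕜)) x) := by
  ext i
  simp [Matrix.toLpLin_apply, Matrix.mulVec, dotProduct]

end ComplexConjugation

section PosSemidef

open scoped ComplexOrder

variable {𝕜 m n : Type*} [RCLike 𝕜] [Finite m] [Finite n]

theorem posSemidef_map_ofReal {M : Matrix n n ℝ} (hM : M.PosSemidef) :
    (M.map ((↑) : ℝ → 𝕜)).PosSemidef := by
  classical
  cases nonempty_fintype n
  obtain ⟨X, rfl⟩ := CStarAlgebra.nonneg_iff_eq_star_mul_self.mp hM.nonneg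
  have hX : (star X * X).map ((↑) : ℝ → 𝕜) = (X.map (↑)).conjTranspose * X.map (↑) := by
    ext i j
    simp [Matrix.mul_apply]
  rw [hX]
  exact Matrix.posSemidef_conjTranspose_mul_self _

theorem posSemidef_fromBlocks_zero {M : Matrix m m 𝕜} (hM : M.PosSemidef) :
    (Matrix.fromBlocks M 0 0 (0 : Matrix n n 𝕜)).PosSemidef := by
  classical
  cases nonempty_fintype m
  cases nonempty_fintype n
  obtain ⟨Y, rfl⟩ := CStarAlgebra.nonneg_iff_eq_star_mul_self.mp hM.nonneg
  have hY : Matrix.fromBlocks (star Y * Y) 0 0 (0 : Matrix n n 𝕜) =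
      (Matrix.fromBlocks Y 0 0 0).conjTranspose * Matrix.fromBlocks Y 0 0 0 := by
    simp [Matrix.fromBlocks_conjTranspose, Matrix.fromBlocks_multiply,
      Matrix.star_eq_conjTranspose]
  rw [hY]
  exact Matrix.posSemidef_conjTranspose_mul_self _

end PosSemidef

namespace LagrangianSystem

variable {N : ℕ} (S : LagrangianSystem N)

section Operators

theorem isHermitian_Omega : S.Omega.IsHermitian := by
  have hskew : (S.Kp * S.θ * S.Kp.transpose).transpose = -(S.Kp * S.θ * S.Kp.transpose) := by
    simp [Matrix.transpose_mul, S.transpose_θ, Matrix.mul_assoc]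
  refine Matrix.IsHermitian.ext fun i j ↦ ?_
  rcases i with i | i <;> rcases j with j | j
  · have hij := congrFun₂ hskew i j
    simp only [Matrix.transpose_apply, Matrix.neg_apply] at hij
    simp [Omega, OmegaP, hij]
  all_goals simp [Omega]

theorem map_conj_Omega : S.Omega.map (starRingEnd ℂ) = -S.Omega := by
  ext i j
  rcases i with i | i <;> rcases j with j | j <;>
    simp [Omega, OmegaP, Complex.conj_ofNat]

theorem map_conj_B : S.B.map (starRingEnd ℂ) = S.B := by
  ext i j
  rcases i with i | i <;> rcases j with j | j <;> simp [B]

theorem posSemidef_Rtilde : S.Rtilde.PosSemidef :=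
  S.posSemidef_R.mul_mul_conjTranspose_same S.Kp

open scoped ComplexOrder in
theorem posSemidef_B : S.B.PosSemidef :=
  posSemidef_fromBlocks_zero (posSemidef_map_ofReal S.posSemidef_Rtilde)

theorem isUnit_Kp : IsUnit S.Kp :=
  Matrix.isUnit_nonsing_inv_iff.mpr
    ((CFC.isUnit_sqrt_iff S.α S.posDef_α.posSemidef.nonneg).mpr S.posDef_α.isUnit)

theorem rank_Rtilde : S.Rtilde.rank = S.R.rank := by
  have hdet : IsUnit S.Kp.det := (Matrix.isUnit_iff_isUnit_det _).mp S.isUnit_Kp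
  rw [Rtilde, Matrix.rank_mul_eq_left_of_isUnit_det _ _ (by rwa [Matrix.det_transpose]),
    Matrix.rank_mul_eq_right_of_isUnit_det _ _ hdet]

theorem B_ne_zero : S.B ≠ 0 := by
  intro hB
  have hR : S.Rtilde = 0 := by
    ext i j
    simpa [B] using congrFun₂ hB (Sum.inl i) (Sum.inl j)
  have hrank := S.rank_R_pos
  rw [← rank_Rtilde, hR, Matrix.rank_zero] at hrank
  exact hrank.false

theorem isSymmetric_opOmega : LinearMap.IsSymmetric S.opOmega :=
  Matrix.isSymmetric_toEuclideanLin_iff.mpr S.isHermitian_Omega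

open scoped ComplexOrder in
theorem isPositive_opB : LinearMap.IsPositive S.opB :=
  Matrix.isPositive_toEuclideanLin_iff.mpr S.posSemidef_B

theorem opB_ne_zero : S.opB ≠ 0 :=
  (map_ne_zero_iff _ (LinearEquiv.injective _)).mpr S.B_ne_zero

theorem isSymmetric_compOmega : LinearMap.IsSymmetric S.compOmega :=
  isSymmetric_compression S.isSymmetric_opOmega

theorem opOmega_euclideanConj (x : Space N) :
    S.opOmega (euclideanConj ℂ _ x) = -euclideanConj ℂ _ (S.opOmega x) := by
  rw [opOmega, toEuclideanLin_euclideanConj, map_conj_Omega, map_neg, LinearMap.neg_apply, map_neg]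

theorem opB_euclideanConj (x : Space N) :
    S.opB (euclideanConj ℂ _ x) = euclideanConj ℂ _ (S.opB x) := by
  rw [opB, toEuclideanLin_euclideanConj, map_conj_B]

theorem compOmega_euclideanConj (x : Space N) :
    S.compOmega (euclideanConj ℂ _ x) = -euclideanConj ℂ _ (S.compOmega x) := by
  refine compression_apply_semilinear inner_euclideanConj_comm (fun y hy ↦ ?_)
    S.opOmega_euclideanConj x
  rw [LinearMap.mem_ker] at hy ⊢
  rw [opB_euclideanConj, hy, map_zero]

variable {S} {μ : ℝ}

theorem neg_mem_spectrum_opOmega (hμ : (μ : ℂ) ∈ spectrum ℂ S.opOmega) :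
    ((-μ : ℝ) : ℂ) ∈ spectrum ℂ S.opOmega := by
  simpa using neg_conj_mem_spectrum euclideanConj_injective S.opOmega_euclideanConj hμ

theorem neg_mem_spectrum_compOmega (hμ : (μ : ℂ) ∈ spectrum ℂ S.compOmega) :
    ((-μ : ℝ) : ℂ) ∈ spectrum ℂ S.compOmega := by
  simpa using neg_conj_mem_spectrum euclideanConj_injective S.compOmega_euclideanConj hμ

end Operators

section ExtremalEigenvalues

theorem abs_le_omegaMax {μ : ℝ} (hμ : (μ : ℂ) ∈ spectrum ℂ S.opOmega) : |μ| ≤ S.omegaMax := by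
  have hbdd := (finite_setOf_ofReal_mem_spectrum S.opOmega).bddAbove
  exact max_le (le_csSup hbdd hμ) (le_csSup hbdd (neg_mem_spectrum_opOmega hμ))

theorem omegaMax_nonneg : 0 ≤ S.omegaMax := by
  rcases {μ : ℝ | (μ : ℂ) ∈ spectrum ℂ S.opOmega}.eq_empty_or_nonempty with hempty | ⟨μ, hμ⟩
  · rw [omegaMax, hempty, Real.sSup_empty]
  · exact (abs_nonneg μ).trans (S.abs_le_omegaMax hμ)

theorem norm_opOmega_apply_le (x : Space N) : ‖S.opOmega x‖ ≤ S.omegaMax * ‖x‖ :=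
  norm_apply_le_of_isSymmetric S.isSymmetric_opOmega S.omegaMax_nonneg
    (fun _ ↦ S.abs_le_omegaMax) x

theorem bMin_mem : S.bMin ≠ 0 ∧ (S.bMin : ℂ) ∈ spectrum ℂ S.opB :=
  Set.Nonempty.csInf_mem
    (exists_ne_zero_ofReal_mem_spectrum S.isPositive_opB.isSymmetric S.opB_ne_zero)
    ((finite_setOf_ofReal_mem_spectrum S.opB).subset fun _ ↦ And.right)

theorem nonneg_of_mem_spectrum_opB {μ : ℝ} (hμ : (μ : ℂ) ∈ spectrum ℂ S.opB) : 0 ≤ μ :=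
  eigenvalue_nonneg_of_nonneg (Module.End.hasEigenvalue_iff_mem_spectrum.mpr hμ)
    fun x ↦ S.isPositive_opB.re_inner_nonneg_right x

theorem bMin_pos : 0 < S.bMin :=
  (S.nonneg_of_mem_spectrum_opB S.bMin_mem.2).lt_of_ne' S.bMin_mem.1

theorem bMin_le {μ : ℝ} (hμ0 : μ ≠ 0) (hμ : (μ : ℂ) ∈ spectrum ℂ S.opB) : S.bMin ≤ μ :=
  csInf_le ((finite_setOf_ofReal_mem_spectrum S.opB).subset fun _ ↦ And.right).bddBelow ⟨hμ0, hμ⟩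

theorem bMin_le_abs {μ : ℝ} (hμ0 : μ ≠ 0) (hμ : (μ : ℂ) ∈ spectrum ℂ S.opB) : S.bMin ≤ |μ| :=
  (S.bMin_le hμ0 hμ).trans (le_abs_self μ)

variable {S}

theorem finite_setOf_pos_mem_spectrum_compOmega :
    {ρ : ℝ | 0 < ρ ∧ (ρ : ℂ) ∈ spectrum ℂ S.compOmega}.Finite :=
  (finite_setOf_ofReal_mem_spectrum S.compOmega).subset fun _ ↦ And.right

theorem abs_mem_spectrum_compOmega {μ : ℝ} (hμ : (μ : ℂ) ∈ spectrum ℂ S.compOmega) :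
    ((|μ| : ℝ) : ℂ) ∈ spectrum ℂ S.compOmega := by
  rcases abs_choice μ with h | h <;> rw [h]
  exacts [hμ, neg_mem_spectrum_compOmega hμ]

theorem rhoMin_mem (hcomp : S.compOmega ≠ 0) :
    0 < S.rhoMin ∧ (S.rhoMin : ℂ) ∈ spectrum ℂ S.compOmega := by
  obtain ⟨μ, hμ0, hμ⟩ := exists_ne_zero_ofReal_mem_spectrum S.isSymmetric_compOmega hcomp
  have habs : |μ| ∈ {ρ : ℝ | 0 < ρ ∧ (ρ : ℂ) ∈ spectrum ℂ S.compOmega} :=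
    ⟨abs_pos.mpr hμ0, abs_mem_spectrum_compOmega hμ⟩
  exact Set.Nonempty.csInf_mem ⟨|μ|, habs⟩ finite_setOf_pos_mem_spectrum_compOmega

theorem rhoMin_le_abs {μ : ℝ} (hμ0 : μ ≠ 0) (hμ : (μ : ℂ) ∈ spectrum ℂ S.compOmega) :
    S.rhoMin ≤ |μ| :=
  csInf_le finite_setOf_pos_mem_spectrum_compOmega.bddBelow
    ⟨abs_pos.mpr hμ0, abs_mem_spectrum_compOmega hμ⟩

theorem rhoMin_le_omegaMax (hcomp : S.compOmega ≠ 0) : S.rhoMin ≤ S.omegaMax := by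
  have hC (x : Space N) : ‖S.compOmega x‖ ≤ S.omegaMax * ‖x‖ :=
    (norm_compression_apply_le S.norm_opOmega_apply_le x).trans
      (mul_le_mul_of_nonneg_left (Submodule.norm_starProjection_apply_le _ x) S.omegaMax_nonneg)
  simpa using (le_abs_self _).trans
    ((Complex.norm_real S.rhoMin).ge.trans (norm_le_of_mem_spectrum hC (rhoMin_mem hcomp).2))

theorem omegaMax_pos (hcomp : S.compOmega ≠ 0) : 0 < S.omegaMax :=
  (rhoMin_mem hcomp).1.trans_le (rhoMin_le_omegaMax hcomp)

end ExtremalEigenvalues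

section DiscRadius

theorem strictAntiOn_c (hω : S.omegaMax ≠ 0) :
    StrictAntiOn S.c (Set.Ioi (2 * S.omegaMax / S.bMin)) := by
  intro β hβ β' _ hββ'
  have hb := S.bMin_pos
  exact mul_lt_mul_of_pos_left
    (inv_strictAnti₀ (sub_pos.mpr hβ) (sub_lt_sub_right hββ' _)) (by positivity)

theorem tendsto_c : Filter.Tendsto S.c Filter.atTop (nhds 0) := by
  have hlim : Filter.Tendsto S.c Filter.atTop (nhds (2 * S.omegaMax ^ 2 / S.bMin * 0)) :=
    (tendsto_inv_atTop_zero.comp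
      (Filter.tendsto_atTop_add_const_right _ _ Filter.tendsto_id)).const_mul _
  rwa [mul_zero] at hlim

theorem two_mul_omegaMax_div_bMin_lt_cInv (hω : S.omegaMax ≠ 0) {y : ℝ} (hy : 0 < y) :
    2 * S.omegaMax / S.bMin < S.cInv y := by
  have hb := S.bMin_pos
  exact lt_add_of_pos_left _ (by positivity)

theorem c_cInv (hω : S.omegaMax ≠ 0) (y : ℝ) : S.c (S.cInv y) = y := by
  have hb := S.bMin_pos.ne'
  rw [c, cInv, add_sub_cancel_right, mul_inv, inv_inv, mul_inv_cancel_left₀ (by positivity)]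

variable {S} {β : ℝ}

theorem c_lt_of_cInv_lt (hω : S.omegaMax ≠ 0) {y : ℝ} (hy : 0 < y) (hβ : S.cInv y < β) :
    S.c β < y :=
  have hy := S.two_mul_omegaMax_div_bMin_lt_cInv hω hy
  (S.strictAntiOn_c hω hy (hy.trans hβ) hβ).trans_eq (S.c_cInv hω y)

theorem two_mul_omegaMax_div_bMin_lt_of_cInv_lt (hcomp : S.compOmega ≠ 0)
    (hβ : S.cInv (S.rhoMin / 2) < β) : 2 * S.omegaMax / S.bMin < β :=
  (S.two_mul_omegaMax_div_bMin_lt_cInv (omegaMax_pos hcomp).ne'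
    (half_pos (rhoMin_mem hcomp).1)).trans hβ

theorem two_mul_c_lt_rhoMin_of_cInv_lt (hcomp : S.compOmega ≠ 0)
    (hβ : S.cInv (S.rhoMin / 2) < β) : 2 * S.c β < S.rhoMin :=
  (lt_div_iff₀' zero_lt_two).mp
    (c_lt_of_cInv_lt (omegaMax_pos hcomp).ne' (half_pos (rhoMin_mem hcomp).1) hβ)

theorem c_pos (hω : S.omegaMax ≠ 0) (hβ : 2 * S.omegaMax / S.bMin < β) : 0 < S.c β := by
  have hb := S.bMin_pos
  exact mul_pos (by positivity) (inv_pos.mpr (sub_pos.mpr hβ))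

theorem nonneg_of_div_bMin_lt (hβ : 2 * S.omegaMax / S.bMin < β) : 0 ≤ β :=
  (div_nonneg (mul_nonneg zero_le_two S.omegaMax_nonneg) S.bMin_pos.le).trans hβ.le

theorem two_mul_omegaMax_lt_mul_bMin (hβ : 2 * S.omegaMax / S.bMin < β) :
    2 * S.omegaMax < β * S.bMin :=
  (div_lt_iff₀ S.bMin_pos).mp hβ

theorem c_mul_mul_bMin_sub (hβ : 2 * S.omegaMax / S.bMin < β) :
    S.c β * (β * S.bMin - 2 * S.omegaMax) = 2 * S.omegaMax ^ 2 := by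
  have hb := S.bMin_pos.ne'
  have hβ0 := (sub_pos.mpr hβ).ne'
  have hfactor : β * S.bMin - 2 * S.omegaMax = (β - 2 * S.omegaMax / S.bMin) * S.bMin := by
    field_simp
  rw [hfactor, c, mul_assoc, inv_mul_cancel_left₀ hβ0, div_mul_cancel₀ _ hb]

end DiscRadius

section Localization

variable {S} {β : ℝ}

theorem im_nonpos_of_mem_spectrum_opA (hβ : 0 ≤ β) {z : ℂ} (hz : z ∈ spectrum ℂ (S.opA β)) :
    z.im ≤ 0 :=
  im_nonpos_of_mem_spectrum_sub_smul S.isSymmetric_opOmega S.isPositive_opB hβ hz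

theorem spectrum_opA_subset_union (S : LagrangianSystem N) (β : ℝ) :
    spectrum ℂ (S.opA β) ⊆ S.sigma0 β ∪ S.sigma1 β := by
  intro z hz
  obtain ⟨b, hb, hzb⟩ := exists_mem_spectrum_norm_mul_add_le S.isPositive_opB.isSymmetric
    S.norm_opOmega_apply_le hz
  by_cases hb0 : (b : ℂ) = 0
  · left
    rw [hb0, mul_zero, zero_add] at hzb
    exact ⟨hz, mem_closedBall_zero_iff.mpr hzb⟩
  · right
    refine ⟨hz, Set.mem_biUnion ⟨hb, hb0⟩ ?_⟩
    rwa [mem_closedBall_iff_norm, sub_neg_eq_add, add_comm]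

theorem le_neg_im_of_mem_sigma1 (hβ : 0 ≤ β) {z : ℂ} (hz : z ∈ S.sigma1 β) :
    β * S.bMin - S.omegaMax ≤ -z.im := by
  obtain ⟨w, ⟨hw, hw0⟩, hzw⟩ := Set.mem_iUnion₂.mp hz.2
  have hw' : (w.re : ℂ) = w := ofReal_re_eq_of_mem_spectrum S.isPositive_opB.isSymmetric hw
  rw [← hw'] at hw hw0 hzw
  have hb : S.bMin ≤ w.re := S.bMin_le (Complex.ofReal_ne_zero.mp hw0) hw
  have him : |z.im + β * w.re| ≤ S.omegaMax := by
    simpa using (Complex.abs_im_le_norm _).trans (mem_closedBall_iff_norm.mp hzw)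
  linarith [(abs_le.mp him).2, mul_le_mul_of_nonneg_left hb hβ]

theorem disjoint_sigma0_sigma1 (hβ : 2 * S.omegaMax / S.bMin < β) :
    Disjoint (S.sigma0 β) (S.sigma1 β) := by
  rw [Set.disjoint_left]
  intro z hz0 hz1
  have hzω : -z.im ≤ S.omegaMax := (neg_le_abs _).trans
    ((Complex.abs_im_le_norm z).trans (mem_closedBall_zero_iff.mp hz0.2))
  linarith [le_neg_im_of_mem_sigma1 (nonneg_of_div_bMin_lt hβ) hz1,
    two_mul_omegaMax_lt_mul_bMin hβ]

variable (S β) in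
/-- The union of the discs `D(ρ; c(β))` over the nonzero eigenvalues `ρ` of `P_B^⊥ Ω P_B^⊥`, which
contains the frequencies of the underdamped low-loss modes. -/
def lowLossDiscs : Set ℂ :=
  ⋃ ρ ∈ spectrum ℂ S.compOmega \ {0}, Metric.closedBall ρ (S.c β)

theorem mem_lowLossDiscs_iff {z : ℂ} : z ∈ S.lowLossDiscs β ↔
    ∃ ρ : ℝ, ρ ≠ 0 ∧ (ρ : ℂ) ∈ spectrum ℂ S.compOmega ∧ ‖z - ρ‖ ≤ S.c β := by
  simp only [lowLossDiscs, Set.mem_iUnion₂, mem_closedBall_iff_norm, exists_prop]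
  constructor
  · rintro ⟨w, ⟨hw, hw0⟩, hzw⟩
    have hw' : (w.re : ℂ) = w := ofReal_re_eq_of_mem_spectrum S.isSymmetric_compOmega hw
    rw [← hw'] at hw hw0 hzw
    exact ⟨w.re, Complex.ofReal_ne_zero.mp hw0, hw, hzw⟩
  · rintro ⟨ρ, hρ0, hρ, hzρ⟩
    exact ⟨ρ, ⟨hρ, Complex.ofReal_ne_zero.mpr hρ0⟩, hzρ⟩

theorem rhoMin_sub_c_le_abs_re {z : ℂ} (hz : z ∈ S.lowLossDiscs β) :
    S.rhoMin - S.c β ≤ |z.re| := by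
  obtain ⟨ρ, hρ0, hρ, hzρ⟩ := mem_lowLossDiscs_iff.mp hz
  have hre : |z.re - ρ| ≤ S.c β := by
    simpa using (Complex.abs_re_le_norm _).trans hzρ
  have htri := abs_sub_abs_le_abs_sub ρ z.re
  rw [abs_sub_comm] at htri
  linarith [rhoMin_le_abs hρ0 hρ]

theorem abs_im_le_c {z : ℂ} (hz : z ∈ S.lowLossDiscs β) : |z.im| ≤ S.c β := by
  obtain ⟨ρ, -, -, hzρ⟩ := mem_lowLossDiscs_iff.mp hz
  simpa using (Complex.abs_im_le_norm _).trans hzρ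

theorem disjoint_closedBall_lowLossDiscs (hc : 2 * S.c β < S.rhoMin) :
    Disjoint (Metric.closedBall (0 : ℂ) (S.c β)) (S.lowLossDiscs β) := by
  rw [Set.disjoint_left]
  intro z hz0 hz1
  linarith [mem_closedBall_zero_iff.mp hz0, rhoMin_sub_c_le_abs_re hz1, Complex.abs_re_le_norm z]

theorem mem_closedBall_or_mem_lowLossDiscs (hβ : 2 * S.omegaMax / S.bMin < β) {z : ℂ}
    (hz : z ∈ S.sigma0 β) : z ∈ Metric.closedBall 0 (S.c β) ∨ z ∈ S.lowLossDiscs β := by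
  have hzω : ‖z‖ ≤ S.omegaMax := mem_closedBall_zero_iff.mp hz.2
  have hgap : 0 < β * S.bMin - 2 * S.omegaMax := sub_pos.mpr (two_mul_omegaMax_lt_mul_bMin hβ)
  have hnorm : ‖Complex.I * β‖ = β := by simp [abs_of_nonneg (nonneg_of_div_bMin_lt hβ)]
  obtain ⟨ρ, hρ, hρz⟩ := exists_mem_spectrum_compression_norm_sub_mul_le
    S.isPositive_opB.isSymmetric S.bMin_pos.le (fun _ ↦ S.bMin_le_abs) S.norm_opOmega_apply_le
    S.omegaMax_nonneg S.isSymmetric_compOmega hz.1 (by rw [hnorm]; linarith)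
  rw [hnorm, norm_sub_rev] at hρz
  have hzρ : ‖z - ρ‖ ≤ S.c β := by
    refine le_of_mul_le_mul_right ?_ hgap
    calc ‖z - ρ‖ * (β * S.bMin - 2 * S.omegaMax)
        ≤ ‖z - ρ‖ * (β * S.bMin - S.omegaMax - ‖z‖) :=
          mul_le_mul_of_nonneg_left (by linarith) (norm_nonneg _)
      _ ≤ S.omegaMax ^ 2 := hρz
      _ ≤ S.c β * (β * S.bMin - 2 * S.omegaMax) := by
        rw [c_mul_mul_bMin_sub hβ]
        linarith [sq_nonneg S.omegaMax]
  by_cases hρ0 : ρ = 0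
  · left
    rwa [hρ0, Complex.ofReal_zero, sub_zero, ← mem_closedBall_zero_iff] at hzρ
  · exact Or.inr (mem_lowLossDiscs_iff.mpr ⟨ρ, hρ0, hρ, hzρ⟩)

theorem mem_sigma0_of_neg_im_le (hβ : 2 * S.omegaMax / S.bMin < β) (hc : S.c β ≤ S.omegaMax)
    {z : ℂ} (hz : z ∈ spectrum ℂ (S.opA β)) (hzc : -z.im ≤ S.c β) : z ∈ S.sigma0 β := by
  refine (S.spectrum_opA_subset_union β hz).resolve_right fun hz1 ↦ ?_
  linarith [le_neg_im_of_mem_sigma1 (nonneg_of_div_bMin_lt hβ) hz1,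
    two_mul_omegaMax_lt_mul_bMin hβ]

theorem sigma0_eq_union (hβ : 2 * S.omegaMax / S.bMin < β) (hc : S.c β ≤ S.omegaMax) :
    S.sigma0 β = (spectrum ℂ (S.opA β) ∩ Metric.closedBall 0 (S.c β)) ∪
      (spectrum ℂ (S.opA β) ∩ S.lowLossDiscs β) := by
  refine subset_antisymm (fun z hz ↦ ?_) (Set.union_subset ?_ ?_)
  · exact (mem_closedBall_or_mem_lowLossDiscs hβ hz).imp (⟨hz.1, ·⟩) (⟨hz.1, ·⟩)
  · exact Set.inter_subset_inter_right _ (Metric.closedBall_subset_closedBall hc)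
  · exact fun z hz ↦ mem_sigma0_of_neg_im_le hβ hc hz.1 ((neg_le_abs _).trans (abs_im_le_c hz.2))

theorem spectrum_inter_closedBall_eq (hβ : 2 * S.omegaMax / S.bMin < β)
    (hc : S.c β ≤ S.omegaMax) (hcρ : 2 * S.c β < S.rhoMin) :
    spectrum ℂ (S.opA β) ∩ Metric.closedBall 0 (S.c β) =
      {z | z ∈ spectrum ℂ (S.opA β) ∧ (0 ≤ -z.im ∧ -z.im ≤ S.c β) ∧ |z.re| ≤ S.c β} := by
  ext z
  constructor
  · rintro ⟨hz, hz0⟩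
    have hzc : ‖z‖ ≤ S.c β := mem_closedBall_zero_iff.mp hz0
    exact ⟨hz, ⟨neg_nonneg.mpr (im_nonpos_of_mem_spectrum_opA (nonneg_of_div_bMin_lt hβ) hz),
      (neg_le_abs _).trans ((Complex.abs_im_le_norm z).trans hzc)⟩,
      (Complex.abs_re_le_norm z).trans hzc⟩
  · rintro ⟨hz, ⟨-, him⟩, hre⟩
    refine ⟨hz, (mem_closedBall_or_mem_lowLossDiscs hβ
      (mem_sigma0_of_neg_im_le hβ hc hz him)).resolve_right fun hz1 ↦ ?_⟩
    linarith [rhoMin_sub_c_le_abs_re hz1]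

theorem spectrum_inter_lowLossDiscs_eq (hβ : 2 * S.omegaMax / S.bMin < β)
    (hc : S.c β ≤ S.omegaMax) (hcρ : 2 * S.c β < S.rhoMin) :
    spectrum ℂ (S.opA β) ∩ S.lowLossDiscs β =
      {z | z ∈ spectrum ℂ (S.opA β) ∧ (0 ≤ -z.im ∧ -z.im ≤ S.c β) ∧
        S.rhoMin - S.c β ≤ |z.re|} := by
  ext z
  constructor
  · rintro ⟨hz, hz1⟩
    exact ⟨hz, ⟨neg_nonneg.mpr (im_nonpos_of_mem_spectrum_opA (nonneg_of_div_bMin_lt hβ) hz),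
      (neg_le_abs _).trans (abs_im_le_c hz1)⟩, rhoMin_sub_c_le_abs_re hz1⟩
  · rintro ⟨hz, ⟨-, him⟩, hre⟩
    refine ⟨hz, (mem_closedBall_or_mem_lowLossDiscs hβ
      (mem_sigma0_of_neg_im_le hβ hc hz him)).resolve_left fun hz0 ↦ ?_⟩
    linarith [mem_closedBall_zero_iff.mp hz0, Complex.abs_re_le_norm z]

theorem spectrum_inter_lowLossDiscs_nonempty (hcomp : S.compOmega ≠ 0)
    (hβ : 2 * S.omegaMax / S.bMin < β) (hcρ : 2 * S.c β < S.rhoMin) :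
    (spectrum ℂ (S.opA β) ∩ S.lowLossDiscs β).Nonempty := by
  have hω : 0 < S.omegaMax := omegaMax_pos hcomp
  have hc : 0 < S.c β := c_pos hω.ne' hβ
  have hcω : S.c β < S.omegaMax := by linarith [rhoMin_le_omegaMax hcomp]
  have hnorm : ‖Complex.I * β‖ = β := by simp [abs_of_nonneg (nonneg_of_div_bMin_lt hβ)]
  refine spectrum_inter_iUnion_closedBall_nonempty S.isPositive_opB.isSymmetric S.bMin_pos.le
    (fun _ ↦ S.bMin_le_abs) S.norm_opOmega_apply_le hω.le S.isSymmetric_compOmega hcomp ?_ hc.le ?_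
  · rw [hnorm, mul_sub, c_mul_mul_bMin_sub hβ]
    linarith [mul_self_lt_mul_self hc.le hcω, sq S.omegaMax]
  · rintro w ⟨hw, hw0⟩
    have hw' : (w.re : ℂ) = w := ofReal_re_eq_of_mem_spectrum S.isSymmetric_compOmega hw
    rw [← hw'] at hw hw0
    linarith [rhoMin_le_abs (Complex.ofReal_ne_zero.mp hw0) hw, Complex.abs_re_le_norm w]

end Localization

section Modes

variable {S} {β : ℝ}

/-- The modal dichotomy formed by the spectral subspaces of `A(β)`. -/
noncomputable def modalDichotomy (hβ : 2 * S.omegaMax / S.bMin < β) (hc : S.c β ≤ S.omegaMax)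
    (hcρ : 2 * S.c β < S.rhoMin) : S.ModalDichotomy β where
  Hhl := spectralSubspace (S.opA β) (S.sigma1 β)
  Hll := spectralSubspace (S.opA β) (S.sigma0 β)
  Hll0 := spectralSubspace (S.opA β) (spectrum ℂ (S.opA β) ∩ Metric.closedBall 0 (S.c β))
  Hll1 := spectralSubspace (S.opA β) (spectrum ℂ (S.opA β) ∩ S.lowLossDiscs β)
  inv_hl := apply_mem_spectralSubspace _ _
  inv_ll := apply_mem_spectralSubspace _ _
  inv_ll0 := apply_mem_spectralSubspace _ _
  inv_ll1 := apply_mem_spectralSubspace _ _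
  isCompl_hl_ll := by
    refine ⟨disjoint_spectralSubspace _ (disjoint_sigma0_sigma1 hβ).symm, ?_⟩
    rw [codisjoint_iff, ← spectralSubspace_union, Set.union_comm]
    exact spectralSubspace_eq_top (S.spectrum_opA_subset_union β)
  spectrum_ll := spectrum_restrict_spectralSubspace_of_subset Set.inter_subset_left
  spectrum_hl := spectrum_restrict_spectralSubspace_of_subset Set.inter_subset_left
  disjoint_ll := disjoint_spectralSubspace _
    ((disjoint_closedBall_lowLossDiscs hcρ).mono Set.inter_subset_right Set.inter_subset_right)
  sup_ll := by rw [← spectralSubspace_union, ← sigma0_eq_union hβ hc]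
  spectrum_ll0 := spectrum_restrict_spectralSubspace_of_subset Set.inter_subset_left
  spectrum_ll1 :=
    spectrum_restrict_spectralSubspace_of_subset Set.inter_subset_left

theorem ModalDichotomy.eq_modalDichotomy (hβ : 2 * S.omegaMax / S.bMin < β)
    (hc : S.c β ≤ S.omegaMax) (hcρ : 2 * S.c β < S.rhoMin) (D : S.ModalDichotomy β) :
    D = modalDichotomy hβ hc hcρ := by
  have htop := spectralSubspace_eq_top (S.spectrum_opA_subset_union β)
  have hdisj : Disjoint (spectrum ℂ (S.opA β) ∩ Metric.closedBall 0 (S.c β))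
      (spectrum ℂ (S.opA β) ∩ S.lowLossDiscs β) :=
    (disjoint_closedBall_lowLossDiscs hcρ).mono Set.inter_subset_right Set.inter_subset_right
  have hll : D.Hll = spectralSubspace (S.opA β) (S.sigma0 β) :=
    eq_spectralSubspace_of_sup_eq (disjoint_sigma0_sigma1 hβ) D.inv_ll D.inv_hl
      D.spectrum_ll.subset D.spectrum_hl.subset (by rw [htop, D.isCompl_hl_ll.symm.sup_eq_top])
  rw [sigma0_eq_union hβ hc] at hll
  refine ModalDichotomy.ext ?_ ?_ ?_ ?_
  · exact eq_spectralSubspace_of_sup_eq (disjoint_sigma0_sigma1 hβ).symm D.inv_hl D.inv_ll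
      D.spectrum_hl.subset D.spectrum_ll.subset
      (by rw [Set.union_comm, htop, D.isCompl_hl_ll.sup_eq_top])
  · rw [hll, ← sigma0_eq_union hβ hc]
    rfl
  · exact eq_spectralSubspace_of_sup_eq hdisj D.inv_ll0 D.inv_ll1
      D.spectrum_ll0.subset D.spectrum_ll1.subset (D.sup_ll.trans hll)
  · exact eq_spectralSubspace_of_sup_eq hdisj.symm D.inv_ll1 D.inv_ll0
      D.spectrum_ll1.subset D.spectrum_ll0.subset
      (by rw [sup_comm, Set.union_comm, D.sup_ll, hll])

theorem le_qFactor (hβ : 0 ≤ β) (hc : S.c β < S.rhoMin) {z : ℂ}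
    (hz : z ∈ spectrum ℂ (S.opA β) ∩ S.lowLossDiscs β) :
    ((1 / 2 * ((S.rhoMin - S.c β) / S.c β) : ℝ) : EReal) ≤ qFactor z := by
  have hre : S.rhoMin - S.c β ≤ |z.re| := rhoMin_sub_c_le_abs_re hz.2
  have hz0 : z ≠ 0 := by
    rintro rfl
    rw [Complex.zero_re, abs_zero] at hre
    linarith
  rw [qFactor, if_neg hz0]
  split_ifs with him
  · exact le_top
  · have hpos : 0 < -z.im :=
      neg_pos.mpr ((im_nonpos_of_mem_spectrum_opA hβ hz.1).lt_of_ne him)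
    rw [EReal.coe_le_coe_iff]
    gcongr
    exact (neg_le_abs _).trans (abs_im_le_c hz.2)

theorem ModalDichotomy.exists_isLeast_qFactor (hcomp : S.compOmega ≠ 0)
    (hβ : 2 * S.omegaMax / S.bMin < β) (hcρ : 2 * S.c β < S.rhoMin) (D : S.ModalDichotomy β) :
    ∃ m : EReal, IsLeast (qFactor '' D.spec1) m ∧
      ((1 / 2 * ((S.rhoMin - S.c β) / S.c β) : ℝ) : EReal) ≤ m := by
  have hspec : D.spec1 = spectrum ℂ (S.opA β) ∩ S.lowLossDiscs β := D.spectrum_ll1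
  obtain ⟨z, hz, hmin⟩ := Set.exists_min_image _ qFactor
    ((S.opA β).finite_spectrum.inter_of_left (S.lowLossDiscs β))
    (spectrum_inter_lowLossDiscs_nonempty hcomp hβ hcρ)
  have hc : S.c β < S.rhoMin := by linarith [c_pos (omegaMax_pos hcomp).ne' hβ]
  rw [hspec]
  exact ⟨qFactor z, ⟨Set.mem_image_of_mem _ hz, Set.forall_mem_image.mpr hmin⟩,
    le_qFactor (nonneg_of_div_bMin_lt hβ) hc hz⟩

theorem ModalDichotomy.re_ne_zero_of_mem_spec1 (hc : S.c β < S.rhoMin) (D : S.ModalDichotomy β)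
    {z : ℂ} (hz : z ∈ D.spec1) : z.re ≠ 0 :=
  abs_pos.mp ((sub_pos.mpr hc).trans_le (rhoMin_sub_c_le_abs_re (D.spectrum_ll1.subset hz).2))

end Modes

end LagrangianSystem

theorem isUnderdamped_of_eventually {ζ : ℝ → ℂ} (hζ : ∀ᶠ β in Filter.atTop, (ζ β).re ≠ 0) :
    IsUnderdamped ζ := by
  obtain ⟨β₀, hβ₀⟩ := Filter.eventually_atTop.mp hζ
  exact ⟨max 0 β₀, le_max_left _ _, fun β hβ ↦ hβ₀ β ((le_max_right _ _).trans hβ.le)⟩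

open LagrangianSystem

theorem mainTheorem10 {N : ℕ} (S : LagrangianSystem N)
    (hrank : S.R.rank < N) (hcomp : S.compOmega ≠ 0) :
    StrictAntiOn S.c (Set.Ioi (2 * S.omegaMax / S.bMin)) ∧
    Filter.Tendsto S.c Filter.atTop (nhds 0) ∧
    S.rhoMin / 2 ≤ S.omegaMax / 2 ∧
    (∀ β : ℝ, S.cInv (S.rhoMin / 2) < β →
      2 * S.omegaMax / S.bMin < β ∧
      max (S.c β) (S.rhoMin / 2) < S.rhoMin - S.c β ∧
      Nonempty (S.ModalDichotomy β) ∧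
      Subsingleton (S.ModalDichotomy β) ∧
      ∀ D : S.ModalDichotomy β,
        D.spec0 = {ζ | ζ ∈ spectrum ℂ (S.opA β) ∧
          (0 ≤ -ζ.im ∧ -ζ.im ≤ S.c β) ∧ |ζ.re| ≤ S.c β} ∧
        D.spec1 = {ζ | ζ ∈ spectrum ℂ (S.opA β) ∧
          (0 ≤ -ζ.im ∧ -ζ.im ≤ S.c β) ∧ S.rhoMin - S.c β ≤ |ζ.re|} ∧
        (∃ m : EReal, IsLeast (qFactor '' D.spec1) m ∧
          ((1 / 2 * ((S.rhoMin - S.c β) / S.c β) : ℝ) : EReal) ≤ m) ∧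
        1 / 4 * (S.rhoMin / S.c β) < 1 / 2 * ((S.rhoMin - S.c β) / S.c β) ∧
        1 / 2 ≤ 1 / 4 * (S.rhoMin / S.c β) ∧
        ∀ ζ ∈ D.spec1, ζ.re ≠ 0) ∧
    ∀ ζ : ℝ → ℂ,
      (∀ᶠ β in Filter.atTop, ∃ D : S.ModalDichotomy β, ζ β ∈ D.spec1) → IsUnderdamped ζ := by
  have hω : S.omegaMax ≠ 0 := (omegaMax_pos hcomp).ne'
  have hρω : S.rhoMin ≤ S.omegaMax := rhoMin_le_omegaMax hcomp
  refine ⟨S.strictAntiOn_c hω, S.tendsto_c, by linarith, fun β h ↦ ?_, fun ζ hζ ↦ ?_⟩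
  · have hβ := two_mul_omegaMax_div_bMin_lt_of_cInv_lt hcomp h
    have hcρ : 2 * S.c β < S.rhoMin := two_mul_c_lt_rhoMin_of_cInv_lt hcomp h
    have hc0 : 0 < S.c β := c_pos hω hβ
    have hc : S.c β ≤ S.omegaMax := by linarith
    refine ⟨hβ, max_lt (by linarith) (by linarith), ⟨modalDichotomy hβ hc hcρ⟩,
      ⟨fun D D' ↦ (D.eq_modalDichotomy hβ hc hcρ).trans (D'.eq_modalDichotomy hβ hc hcρ).symm⟩,
      fun D ↦ ⟨D.spectrum_ll0.trans (spectrum_inter_closedBall_eq hβ hc hcρ),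
        D.spectrum_ll1.trans (spectrum_inter_lowLossDiscs_eq hβ hc hcρ),
        D.exists_isLeast_qFactor hcomp hβ hcρ, by field_simp; linarith, by field_simp; linarith,
        fun _ ↦ D.re_ne_zero_of_mem_spec1 (by linarith)⟩⟩
  · refine isUnderdamped_of_eventually ?_
    filter_upwards [hζ, Filter.eventually_gt_atTop (S.cInv (S.rhoMin / 2))] with β ⟨D, hD⟩ h
    have hcρ : 2 * S.c β < S.rhoMin := two_mul_c_lt_rhoMin_of_cInv_lt hcomp h
    exact D.re_ne_zero_of_mem_spec1 (by linarith [(rhoMin_mem hcomp).1]) hD
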